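/- Let $G$ be a Polish group with identity $e$ and let $\mu$ be a Borel probability measure on $G$. For $x\in G$ let $\mathrm{RW}(x,\mu)$ be the law on $G^{\mathbb N}$ of $S_n=xX_1X_2\cdots X_n$, $n\ge 0$, where $X_1,X_2,\dots$ are i.i.d. with distribution $\mu$. A successful exact coupling of $\mathrm{RW}(x,\mu)$ and $\mathrm{RW}(y,\mu)$ is a triple $(S,S',T)$ on some probability space $(\Omega,\mathcal F,\mathbf P)$ with $S\sim\mathrm{RW}(x,\mu)$, $S'\sim\mathrm{RW}(y,\mu)$, and $T$ a random time with values in $\{0,1,2,\dots,\infty\}$ (the coupling time) such that $S_n=S'_n$ for all $n\ge T$ and $T<\infty$ almost surely. Let $G_s$ be the set of all $x\in G$ for which $\mathrm{RW}(e,\mu)$ and $\mathrm{RW}(x,\mu)$ admit a successful exact coupling. Write $\mu^n$ for the $n$-fold convolution of $\mu$, $\nu_1\wedge\nu_2$ for the largest measure below both $\nu_1$ and $\nu_2$, $\theta_x^{-1}\nu(B)=\nu(xB)$ for Borel $B\subseteq G$, and $\|\nu\|=\sup_B\nu(B)-\inf_B\nu(B)$ ($B$ ranging over Borel sets) for the total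 variation of a finite signed measure $\nu$. **Theorem.** Fix $x\in G$. 1. If $x\in G_s$, then there is $n\ge 1$ such that $\mu^n\wedge\theta_x^{-1}\mu^n\ne 0$. 2. Conversely, let $n_0\ge 1$ be such that $\mu^{n_0}\wedge\theta_x^{-1}\mu^{n_0}\neq 0$, and suppose there is a Borel set $B\subseteq G$ with $\mu^{n_0}(B)=1$ such that $x$ commutes with every element of $B$. Then $x\in G_s$, and there exists a successful exact coupling of $\mathrm{RW}(e,\mu)$ and $\mathrm{RW}(x,\mu)$ with a coupling time $T$ satisfying $\mathbf P(T=n_0)>0$. Moreover, there is a constant $C=C(\mu,x,n_0)>0$ such that for all $S\sim\mathrm{RW}(e,\mu)$ and $S^x\sim\mathrm{RW}(x,\mu)$ under a probability measure $\mathbf P$: - if $x$ has infinite order, then $$\|\mathbf P(S_n\in\cdot)-\mathbf P(S^x_n\in\cdot)\|\le \frac{C}{\sqrt n},\qquad n\ge 1;$$ - if $x$ has finite order, there is $\rho=\rho(\mu,x,n_0)\in(0,1)$ such that $$\|\mathbf P(S_n\in\cdot)-\mathbf P(S^x_n\in\cdot)\|\le C\rho^n,\qquad n\ge 1.$$ 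-/

import Mathlib

open MeasureTheory

universe u v

namespace ExactCoupling

section Measures

variable {G : Type u} [Group G] [MeasurableSpace G]

/-- The `n`-fold convolution `μ ^ n`, with `μ ^ 0` the unit mass at the identity. -/
noncomputable def convPow (μ : Measure G) : ℕ → Measure G
  | 0 => Measure.dirac 1
  | n + 1 => (convPow μ n).mconv μ

/-- The left shift `θ_x ν`, that is `θ_x ν (B) = ν (x⁻¹ B)`; the inverse operation `θ_x⁻¹` is
`leftShift x⁻¹`. -/
noncomputable def leftShift (x : G) (ν : Measure G) : Measure G :=
  ν.map (fun y => x * y)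

/-- The path `n ↦ x X₁ X₂ ⋯ Xₙ` started at `x`; the step `Xᵢ₊₁` is `X i`. -/
def walk (x : G) (X : ℕ → G) (n : ℕ) : G :=
  x * ((List.range n).map X).prod

/-- `RW(x, μ)`: the law on `G^ℕ` of the right random walk started at `x` whose steps are
i.i.d. with distribution `μ`. -/
noncomputable def randomWalkLaw (x : G) (μ : Measure G) [IsProbabilityMeasure μ] :
    Measure (ℕ → G) :=
  (Measure.infinitePi (fun _ : ℕ => μ)).map (walk x)

theorem measurable_walk [MeasurableMul₂ G] (x : G) : Measurable (walk x) := by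
  refine measurable_pi_lambda _ fun n => ?_
  induction n with
  | zero => simp [walk]
  | succ n ih =>
    have h : (fun X : ℕ → G => walk x X (n + 1)) = fun X => walk x X n * X n := by
      funext X
      simp [walk, List.range_succ, mul_assoc]
    rw [h]
    exact ih.mul (measurable_pi_apply n)

instance [MeasurableMul₂ G] (x : G) (μ : Measure G) [IsProbabilityMeasure μ] :
    IsProbabilityMeasure (randomWalkLaw x μ) :=
  Measure.isProbabilityMeasure_map (measurable_walk x).aemeasurable

/-- `S ∼ RW(x, μ)` under `P`. -/
structure IsRandomWalk {Ω : Type v} [MeasurableSpace Ω] (P : Measure Ω) (x : G) (μ : Measure G)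
    [IsProbabilityMeasure μ] (S : Ω → ℕ → G) : Prop where
  measurable : Measurable S
  law : P.map S = randomWalkLaw x μ

/-- `(S, S', T)` is an exact coupling of `RW(x, μ)` and `RW(y, μ)` on `(Ω, P)`; the coupling
time `T` may take the value `∞`. -/
structure IsExactCoupling {Ω : Type v} [MeasurableSpace Ω] (P : Measure Ω) (x y : G)
    (μ : Measure G) [IsProbabilityMeasure μ] (S S' : Ω → ℕ → G) (T : Ω → ℕ∞) : Prop where
  left : IsRandomWalk P x μ S
  right : IsRandomWalk P y μ S'
  measurable_time : Measurable T
  coupled : ∀ (ω : Ω) (n : ℕ), T ω ≤ (n : ℕ∞) → S ω n = S' ω n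

/-- An exact coupling whose coupling time is almost surely finite. -/
structure IsSuccessfulExactCoupling {Ω : Type v} [MeasurableSpace Ω] (P : Measure Ω) (x y : G)
    (μ : Measure G) [IsProbabilityMeasure μ] (S S' : Ω → ℕ → G) (T : Ω → ℕ∞) : Prop
    extends IsExactCoupling P x y μ S S' T where
  ae_finite : ∀ᵐ ω ∂P, T ω < ⊤

/-- The successful exact coupling set `G_s`. The universe of the probability space is immaterial,
see `mem_successfulCouplingSet`. -/
def successfulCouplingSet (μ : Measure G) [IsProbabilityMeasure μ] : Set G :=
  {x | ∃ (Ω : Type u) (_ : MeasurableSpace Ω) (P : Measure Ω) (_ : IsProbabilityMeasure P)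
    (S S' : Ω → ℕ → G) (T : Ω → ℕ∞), IsSuccessfulExactCoupling P 1 x μ S S' T}

/-- A successful exact coupling on a probability space in any universe gives a point of `G_s`. -/
theorem mem_successfulCouplingSet (μ : Measure G) [IsProbabilityMeasure μ] (x : G)
    {Ω : Type v} [MeasurableSpace Ω] (P : Measure Ω) [IsProbabilityMeasure P]
    (S S' : Ω → ℕ → G) (T : Ω → ℕ∞) (h : IsSuccessfulExactCoupling P 1 x μ S S' T) :
    x ∈ successfulCouplingSet μ := by
  let E : Type u := {t : (ℕ → G) × (ℕ → G) × ℕ∞ //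
    ∀ n : ℕ, t.2.2 ≤ (n : ℕ∞) → t.1 n = t.2.1 n}
  let f : Ω → E := fun ω => ⟨(S ω, S' ω, T ω), fun n hn => h.coupled ω n hn⟩
  have hf : Measurable f := Measurable.subtype_mk
    (h.left.measurable.prodMk (h.right.measurable.prodMk h.measurable_time))
  have m1 : Measurable fun t : E => t.1.1 := measurable_fst.comp measurable_subtype_coe
  have m2 : Measurable fun t : E => t.1.2.1 :=
    measurable_fst.comp (measurable_snd.comp measurable_subtype_coe)
  have m3 : Measurable fun t : E => t.1.2.2 :=
    measurable_snd.comp (measurable_snd.comp measurable_subtype_coe)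
  refine ⟨E, inferInstance, P.map f, Measure.isProbabilityMeasure_map hf.aemeasurable,
    fun t => t.1.1, fun t => t.1.2.1, fun t => t.1.2.2,
    ⟨⟨⟨m1, ?_⟩, ⟨m2, ?_⟩, m3, fun t n hn => t.2 n hn⟩, ?_⟩⟩
  · rw [Measure.map_map m1 hf]
    exact h.left.law
  · rw [Measure.map_map m2 hf]
    exact h.right.law
  · exact (ae_map_iff hf.aemeasurable (m3 (MeasurableSet.of_discrete (s := {t : ℕ∞ | t < ⊤})))).2 h.ae_finite

end Measures

/-- The total variation `sup_B ν(B) - inf_B ν(B)` of a finite signed measure, over measurable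
sets `B`. -/
noncomputable def totalVariation {E : Type u} [MeasurableSpace E] (ν : SignedMeasure E) : ℝ :=
  (⨆ B : {B : Set E // MeasurableSet B}, ν B.1) - ⨅ B : {B : Set E // MeasurableSet B}, ν B.1

end ExactCoupling

/-! Necessity: a successful coupling gives some event {T ≤ n}, n ≥ 1, positive probability. On it
S_n = S'_n, so the law of S_n restricted to it is a nonzero measure below both μ^n and θ_x μ^n
(`exists_inf_leftShift_ne_zero`).

Sufficiency rests on the decay of the discrepancy between μ^n and θ_x μ^n, measured one-sidedly by
`DominatedUpTo`. Let ν = μ^{n₀} and c = ν ∧ θ_x⁻¹ν. Both c and θ_x c lie below ν, so ν = κ + λ + θ_x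
λ with λ = c/2: with positive probability a step of law ν carries an extra factor x decided by a
fair coin. Since x commutes with almost every step, these factors collect on the left, and j coins
produce a power of x with exponent Bin(j, 1/2). One further factor x changes this law by O(j^{-1/2})
(`abs_sum_choose_mul_sub_le`), and `abs_addShift_iterate_sub_le` averages over the number of coins.
If x has finite order d, averaging over its cyclic group yields a nonzero x-invariant U ≤ ν^d
(`exists_invariant_le_convPow`). Each block of d steps of law ν then shrinks the discrepancy by the
factor 1 - U(G), so decay is geometric.

A vanishing discrepancy yields a coupling. By the Markov property the path laws after time n differ
no more than the laws at time n. At each n, the part that the two remaining path laws share after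
time n is peeled off (`exists_path_splitting`), and matching parts are glued along their common
future (`exists_glue`). The mass left over tends to 0, so the coupling time is almost surely finite.
-/

namespace ExactCoupling
open Measure Filter
open scoped ENNReal Topology ProbabilityTheory

/-! ### One-sided discrepancy of measures -/

/-- `a` exceeds `b` by at most `ε` on every measurable set. -/
def DominatedUpTo {α : Type*} [MeasurableSpace α] (ε : ℝ≥0∞) (a b : Measure α) : Prop :=
  ∀ B, MeasurableSet B → a B ≤ b B + ε

namespace DominatedUpTo

variable {α β : Type*} [MeasurableSpace α] [MeasurableSpace β] {ε : ℝ≥0∞} {a b : Measure α}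

theorem map (h : DominatedUpTo ε a b) {f : α → β} (hf : Measurable f) :
    DominatedUpTo ε (a.map f) (b.map f) := fun B hB => by
  rw [map_apply hf hB, map_apply hf hB]
  exact h _ (hf hB)

theorem prod [SFinite a] [SFinite b] (h : DominatedUpTo ε a b) (c : Measure β) [SFinite c] :
    DominatedUpTo (ε * c Set.univ) (a.prod c) (b.prod c) := fun B hB => by
  rw [prod_apply_symm hB, prod_apply_symm hB, ← lintegral_const,
    ← lintegral_add_right _ measurable_const]
  exact lintegral_mono fun y => h _ (measurable_prodMk_right hB)

theorem mconv {M : Type*} [Monoid M] [MeasurableSpace M] [MeasurableMul₂ M] {a b : Measure M}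
    [SFinite a] [SFinite b] (h : DominatedUpTo ε a b) (c : Measure M) [SFinite c] :
    DominatedUpTo (ε * c Set.univ) (a ∗ₘ c) (b ∗ₘ c) :=
  (h.prod c).map measurable_mul

theorem of_add_left {c : Measure α} [IsFiniteMeasure c]
    (h : DominatedUpTo ε (c + a) (c + b)) : DominatedUpTo ε a b := fun B hB => by
  have := h B hB
  rw [add_apply, add_apply, add_assoc] at this
  exact (ENNReal.add_le_add_iff_left (measure_ne_top c B)).1 this

theorem add_left (h : DominatedUpTo ε a b) (c : Measure α) :
    DominatedUpTo ε (c + a) (c + b) := fun B hB => by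
  rw [add_apply, add_apply, add_assoc]
  gcongr
  exact h B hB

theorem mono {ε' : ℝ≥0∞} (h : DominatedUpTo ε a b) (hε : ε ≤ ε') : DominatedUpTo ε' a b :=
  fun B hB => (h B hB).trans (by gcongr)

theorem of_inf_ne_zero [IsProbabilityMeasure a] (h : a ⊓ b ≠ 0) :
    ∃ ε < 1, DominatedUpTo ε a b := by
  have hle : a ⊓ b ≤ a := inf_le_left
  have : IsFiniteMeasure (a ⊓ b) := isFiniteMeasure_of_le a hle
  refine ⟨(a - a ⊓ b) Set.univ, ?_, fun B hB => ?_⟩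
  · rw [sub_apply .univ hle, measure_univ]
    exact ENNReal.sub_lt_self ENNReal.one_ne_top one_ne_zero (by simpa using h)
  · calc a B = (a - a ⊓ b) B + (a ⊓ b) B := by rw [← add_apply, sub_add_cancel_of_le hle]
      _ ≤ (a - a ⊓ b) Set.univ + b B :=
        add_le_add (measure_mono (Set.subset_univ B)) (inf_le_right (a := a) B)
      _ = _ := add_comm _ _

theorem totalVariation_le {E : Type u} [MeasurableSpace E] {a b : Measure E}
    [IsProbabilityMeasure a] [IsProbabilityMeasure b] {r : ℝ} (hr : 0 ≤ r)
    (h : DominatedUpTo (ENNReal.ofReal r) a b) :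
    totalVariation (a.toSignedMeasure - b.toSignedMeasure) ≤ 2 * r := by
  have key : ∀ B, MeasurableSet B → a.real B ≤ b.real B + r := fun B hB => by
    have := ENNReal.toReal_mono (by finiteness) (h B hB)
    rwa [ENNReal.toReal_add (by finiteness) (by finiteness), ENNReal.toReal_ofReal hr] at this
  have hval : ∀ B : {B : Set E // MeasurableSet B},
      (a.toSignedMeasure - b.toSignedMeasure) B.1 = a.real B.1 - b.real B.1 := fun B => by
    rw [_root_.sub_apply, toSignedMeasure_apply_measurable B.2,
      toSignedMeasure_apply_measurable B.2]
  have : Nonempty {B : Set E // MeasurableSet B} := ⟨⟨∅, .empty⟩⟩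
  unfold totalVariation
  have h1 : (⨆ B : {B : Set E // MeasurableSet B},
      (a.toSignedMeasure - b.toSignedMeasure) B.1) ≤ r :=
    ciSup_le fun B => by rw [hval]; linarith [key B.1 B.2]
  have h2 : -r ≤ ⨅ B : {B : Set E // MeasurableSet B},
      (a.toSignedMeasure - b.toSignedMeasure) B.1 :=
    le_ciInf fun B => by
      -- Both measures have mass 1, so the one-sided bound on the complement is the opposite bound
      -- on `B`.
      have := key _ B.2.compl
      rw [probReal_compl_eq_one_sub B.2, probReal_compl_eq_one_sub B.2] at this
      rw [hval]; linarith
  linarith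

end DominatedUpTo

/-! ### Convolution and product measures -/

theorem mconv_univ {M : Type*} [Monoid M] [MeasurableSpace M] [MeasurableMul₂ M]
    (a b : Measure M) [SFinite b] : (a ∗ₘ b) Set.univ = a Set.univ * b Set.univ := by
  rw [mconv, map_apply measurable_mul .univ, Set.preimage_univ, ← Set.univ_prod_univ, prod_prod]

theorem mconv_mono {M : Type*} [Monoid M] [MeasurableSpace M]
    {a b a' b' : Measure M} [SFinite a] [SFinite b] [SFinite a'] [SFinite b'] [MeasurableMul₂ M]
    (h : a ≤ a') (h' : b ≤ b') :
    a ∗ₘ b ≤ a' ∗ₘ b' :=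
  map_mono (prod_mono h h') measurable_mul

theorem leftShift_one {G : Type u} [Group G] [MeasurableSpace G] (a : Measure G) :
    leftShift 1 a = a := by
  simp [leftShift]

theorem infinitePi_map_head_tail {G : Type u} [MeasurableSpace G] (μ : Measure G)
    [IsProbabilityMeasure μ] :
    (infinitePi fun _ : ℕ => μ).map (fun X => (X 0, fun n => X (n + 1))) =
      μ.prod (infinitePi fun _ : ℕ => μ) := by
  have hc : Measurable fun p : G × (ℕ → G) => (fun n => Nat.casesOn n p.1 p.2 : ℕ → G) :=
    measurable_pi_lambda _ fun n => by
      cases n with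
      | zero => exact measurable_fst
      | succ n => exact (measurable_pi_apply n).comp measurable_snd
  have ht : Measurable fun X : ℕ → G => (X 0, fun n => X (n + 1)) :=
    (measurable_pi_apply 0).prodMk (measurable_pi_lambda _ fun n => measurable_pi_apply (n + 1))
  have key : (μ.prod (infinitePi fun _ : ℕ => μ)).map
      (fun p => (fun n => Nat.casesOn n p.1 p.2 : ℕ → G)) = infinitePi fun _ : ℕ => μ := by
    classical
    refine eq_infinitePi _ fun s t hs => ?_
    obtain ⟨N, hN⟩ := s.exists_nat_subset_range
    have hN' : s ⊆ Finset.range (N + 1) := hN.trans (Finset.range_mono N.le_succ)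
    -- Padding with `Set.univ` turns the cylinder over `s` into one over an initial segment, where
    -- index 0 splits off.
    let w : ℕ → Set G := fun i => if i ∈ s then t i else Set.univ
    have hw : ∀ i, MeasurableSet (w i) := fun i => by
      by_cases hi : i ∈ s <;> simp [w, hi, hs i]
    have hpi : (Set.pi s t : Set (ℕ → G)) = Set.pi (Finset.range (N + 1)) w := by
      ext X
      simp only [Set.mem_pi, Finset.mem_coe, w]
      refine ⟨fun h i _ => ?_, fun h i hi => by simpa [hi] using h i (hN' hi)⟩
      by_cases hi : i ∈ s <;> simp [hi, h i]
    have hprod : ∏ i ∈ s, μ (t i) = ∏ i ∈ Finset.range (N + 1), μ (w i) := by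
      rw [← Finset.prod_subset hN' fun i _ hi => by simp [w, hi]]
      exact Finset.prod_congr rfl fun i hi => by simp [w, hi]
    have hpre : (fun p : G × (ℕ → G) => (fun n => Nat.casesOn n p.1 p.2 : ℕ → G)) ⁻¹'
        Set.pi (Finset.range (N + 1)) w =
        w 0 ×ˢ Set.pi (Finset.range N) fun i => w (i + 1) := by
      ext p
      simp only [Set.mem_preimage, Set.mem_pi, Finset.mem_coe, Finset.mem_range, Set.mem_prod]
      refine ⟨fun h => ⟨h 0 (by omega), fun i hi => h (i + 1) (by omega)⟩, fun h i hi => ?_⟩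
      cases i with
      | zero => exact h.1
      | succ i => exact h.2 i (by omega)
    rw [hpi, hprod, Measure.map_apply hc (.pi (Finset.countable_toSet _) fun i _ => hw i), hpre,
      prod_prod, infinitePi_pi _ fun i _ => hw (i + 1), Finset.prod_range_succ', mul_comm]
  conv_lhs => rw [← key]
  rw [map_map ht hc]
  exact Measure.map_id

/-! ### The Markov property of the walk, and necessity -/

section Walk

variable {G : Type u} [Group G] [MeasurableSpace G] [MeasurableMul₂ G]

theorem leftShift_eq_dirac_mconv (x : G) (a : Measure G) [SFinite a] :
    leftShift x a = dirac x ∗ₘ a :=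
  (dirac_mconv x a).symm

instance (a : Measure G) [IsFiniteMeasure a] (n : ℕ) : IsFiniteMeasure (convPow a n) := by
  induction n with
  | zero => rw [convPow]; infer_instance
  | succ n ih => rw [convPow, mconv]; infer_instance

instance (μ : Measure G) [IsProbabilityMeasure μ] (n : ℕ) :
    IsProbabilityMeasure (convPow μ n) := by
  induction n with
  | zero => rw [convPow]; infer_instance
  | succ n ih => rw [convPow, mconv]; exact isProbabilityMeasure_map measurable_mul.aemeasurable

theorem convPow_add (a : Measure G) [IsFiniteMeasure a] (m n : ℕ) :
    convPow a (m + n) = convPow a m ∗ₘ convPow a n := by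
  induction n with
  | zero => rw [add_zero, convPow, mconv_dirac_one]
  | succ n ih => rw [← add_assoc, convPow, convPow, ih, mconv_assoc]

theorem convPow_univ (a : Measure G) [IsFiniteMeasure a] (n : ℕ) :
    convPow a n Set.univ = a Set.univ ^ n := by
  induction n with
  | zero => simp [convPow]
  | succ n ih => rw [convPow, mconv_univ, ih, pow_succ]

theorem mconv_dirac_comm_mconv {x : G} {a b : Measure G} [SFinite a] [SFinite b]
    (ha : a ∗ₘ dirac x = dirac x ∗ₘ a) (hb : b ∗ₘ dirac x = dirac x ∗ₘ b) :
    (a ∗ₘ b) ∗ₘ dirac x = dirac x ∗ₘ (a ∗ₘ b) := by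
  rw [mconv_assoc, hb, ← mconv_assoc, ha, mconv_assoc]

theorem mconv_dirac_comm_convPow {x : G} {a : Measure G} [IsFiniteMeasure a]
    (ha : a ∗ₘ dirac x = dirac x ∗ₘ a) (n : ℕ) :
    convPow a n ∗ₘ dirac x = dirac x ∗ₘ convPow a n := by
  induction n with
  | zero => rw [convPow, mconv_dirac_one, dirac_one_mconv]
  | succ n ih => rw [convPow]; exact mconv_dirac_comm_mconv ih ha

theorem mconv_dirac_comm_of_ae {x : G} {a : Measure G} [SFinite a]
    (h : ∀ᵐ g ∂a, x * g = g * x) : a ∗ₘ dirac x = dirac x ∗ₘ a := by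
  rw [dirac_mconv, mconv_dirac]
  refine Measure.map_congr ?_
  filter_upwards [h] with g hg using hg.symm

/-- The law of the random walk with step distribution `μ` and initial distribution `a`. -/
noncomputable def walkLaw (μ : Measure G) [IsProbabilityMeasure μ] (a : Measure G) :
    Measure (ℕ → G) :=
  (a.prod (infinitePi fun _ : ℕ => μ)).map fun p => walk p.1 p.2

theorem measurable_walk_prod : Measurable fun p : G × (ℕ → G) => walk p.1 p.2 := by
  have : (fun p : G × (ℕ → G) => walk p.1 p.2) = fun p n => p.1 * walk 1 p.2 n := by
    funext p n; simp [walk]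
  rw [this]
  exact measurable_pi_lambda _ fun n =>
    measurable_fst.mul ((measurable_pi_apply n).comp ((measurable_walk 1).comp measurable_snd))

theorem walkLaw_dirac (μ : Measure G) [IsProbabilityMeasure μ] (x : G) :
    walkLaw μ (dirac x) = randomWalkLaw x μ := by
  rw [walkLaw, dirac_prod, map_map measurable_walk_prod measurable_prodMk_left]
  rfl

/-- The Markov property at time 1: the first step is absorbed into the initial law, and the
remaining steps are again i.i.d. and independent of it. -/
theorem walkLaw_map_shift (μ : Measure G) [IsProbabilityMeasure μ] (a : Measure G)
    [IsFiniteMeasure a] : (walkLaw μ a).map (fun S n => S (n + 1)) = walkLaw μ (a ∗ₘ μ) := by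
  have hs : Measurable fun (S : ℕ → G) n => S (n + 1) :=
    measurable_pi_lambda _ fun n => measurable_pi_apply (n + 1)
  have ht : Measurable fun X : ℕ → G => (X 0, fun n => X (n + 1)) :=
    (measurable_pi_apply 0).prodMk (measurable_pi_lambda _ fun n => measurable_pi_apply (n + 1))
  have e : (a ∗ₘ μ).prod (infinitePi fun _ : ℕ => μ) =
      (a.prod (infinitePi fun _ : ℕ => μ)).map
        (fun p => (p.1 * p.2 0, fun n => p.2 (n + 1))) := by
    have h1 : a.prod (μ.prod (infinitePi fun _ : ℕ => μ)) =
        (a.prod (infinitePi fun _ : ℕ => μ)).map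
          (Prod.map id fun X : ℕ → G => (X 0, fun n => X (n + 1))) := by
      rw [← infinitePi_map_head_tail μ, ← map_prod_map _ _ measurable_id ht, Measure.map_id]
    have h2 : (a ∗ₘ μ).prod (infinitePi fun _ : ℕ => μ) =
        (a.prod (μ.prod (infinitePi fun _ : ℕ => μ))).map
          (fun p => (p.1 * p.2.1, p.2.2)) := by
      rw [← prodAssoc_prod, map_map (by fun_prop) MeasurableEquiv.prodAssoc.measurable, mconv,
        ← Measure.map_id (μ := infinitePi fun _ : ℕ => μ),
        map_prod_map _ _ measurable_mul measurable_id]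
      simp only [Measure.map_id]
      rfl
    rw [h2, h1, map_map (by fun_prop) (measurable_id.prodMap ht)]
    rfl
  rw [walkLaw, map_map hs measurable_walk_prod, walkLaw, e, map_map measurable_walk_prod]
  · congr 1
    funext p n
    simp [walk, List.range_succ_eq_map, mul_assoc, Function.comp_def]
  · exact (measurable_fst.mul ((measurable_pi_apply 0).comp measurable_snd)).prodMk
      (hs.comp measurable_snd)

theorem walkLaw_map_shift_iterate (μ : Measure G) [IsProbabilityMeasure μ] (a : Measure G)
    [IsFiniteMeasure a] (k : ℕ) :
    (walkLaw μ a).map (fun S n => S (n + k)) = walkLaw μ (a ∗ₘ convPow μ k) := by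
  induction k with
  | zero => simp only [add_zero, convPow, mconv_dirac_one]; exact Measure.map_id
  | succ k ih =>
    have hs : ∀ k, Measurable fun (S : ℕ → G) n => S (n + k) := fun k =>
      measurable_pi_lambda _ fun n => measurable_pi_apply (n + k)
    have : (fun (S : ℕ → G) n => S (n + (k + 1))) =
        (fun (S : ℕ → G) n => S (n + 1)) ∘ fun (S : ℕ → G) n => S (n + k) := by
      funext S n; simp [add_comm, add_left_comm]
    rw [this, ← map_map (hs 1) (hs k), ih, convPow, ← mconv_assoc, mconv, mconv]
    exact walkLaw_map_shift μ _

theorem randomWalkLaw_map_shift (μ : Measure G) [IsProbabilityMeasure μ] (x : G) (k : ℕ) :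
    (randomWalkLaw x μ).map (fun S n => S (n + k)) = walkLaw μ (leftShift x (convPow μ k)) := by
  rw [← walkLaw_dirac, walkLaw_map_shift_iterate, leftShift_eq_dirac_mconv]

theorem walkLaw_map_zero (μ : Measure G) [IsProbabilityMeasure μ] (a : Measure G)
    [SFinite a] : (walkLaw μ a).map (fun S => S 0) = a := by
  rw [walkLaw, map_map (measurable_pi_apply 0) measurable_walk_prod]
  have : (fun S : ℕ → G => S 0) ∘ (fun p : G × (ℕ → G) => walk p.1 p.2) = Prod.fst := by
    funext p; simp [walk]
  rw [this, Measure.map_fst_prod]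
  simp

theorem randomWalkLaw_map_apply (μ : Measure G) [IsProbabilityMeasure μ] (x : G) (k : ℕ) :
    (randomWalkLaw x μ).map (fun S => S k) = leftShift x (convPow μ k) := by
  have hs : Measurable fun (S : ℕ → G) n => S (n + k) :=
    measurable_pi_lambda _ fun n => measurable_pi_apply (n + k)
  have : SFinite (leftShift x (convPow μ k)) := by rw [leftShift]; infer_instance
  rw [← walkLaw_map_zero μ (leftShift x (convPow μ k)), ← randomWalkLaw_map_shift,
    map_map (measurable_pi_apply 0) hs]
  simp [Function.comp_def]

theorem IsRandomWalk.map_apply {μ : Measure G} [IsProbabilityMeasure μ] {x : G} {Ω : Type v}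
    [MeasurableSpace Ω] {P : Measure Ω} {S : Ω → ℕ → G} (h : IsRandomWalk P x μ S) (n : ℕ) :
    P.map (fun ω => S ω n) = leftShift x (convPow μ n) := by
  rw [← randomWalkLaw_map_apply, ← h.law, map_map (measurable_pi_apply n) h.measurable]
  rfl

theorem leftShift_leftShift (x y : G) (a : Measure G) :
    leftShift x (leftShift y a) = leftShift (x * y) a := by
  rw [leftShift, leftShift, leftShift, map_map (measurable_const_mul x) (measurable_const_mul y)]
  congr 1; funext g; simp [mul_assoc]

theorem leftShift_univ (x : G) (a : Measure G) : leftShift x a Set.univ = a Set.univ := by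
  rw [leftShift, Measure.map_apply (measurable_const_mul x) .univ, Set.preimage_univ]

theorem leftShift_mono (x : G) {a b : Measure G} (h : a ≤ b) : leftShift x a ≤ leftShift x b :=
  map_mono h (measurable_const_mul x)

instance (x : G) (a : Measure G) [IsFiniteMeasure a] : IsFiniteMeasure (leftShift x a) := by
  rw [leftShift]; infer_instance

instance (x : G) (a : Measure G) [IsProbabilityMeasure a] :
    IsProbabilityMeasure (leftShift x a) :=
  isProbabilityMeasure_map (measurable_const_mul x).aemeasurable

/-- A nonzero part of the law of `S n` is shared by both walks of a successful exact coupling. -/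
theorem exists_inf_leftShift_ne_zero {μ : Measure G} [IsProbabilityMeasure μ] {x : G}
    (hx : x ∈ successfulCouplingSet μ) :
    ∃ n : ℕ, 1 ≤ n ∧ convPow μ n ⊓ leftShift x⁻¹ (convPow μ n) ≠ 0 := by
  obtain ⟨Ω, _, P, _, S, S', T, h⟩ := hx
  obtain ⟨n, hn⟩ : ∃ n : ℕ, P {ω | T ω ≤ ((n + 1 : ℕ) : ℕ∞)} ≠ 0 := by
    by_contra! hcon
    have h0 : P (⋃ n : ℕ, {ω | T ω ≤ ((n + 1 : ℕ) : ℕ∞)}) = 0 := measure_iUnion_null hcon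
    have h1 : ∀ᵐ ω ∂P, ω ∉ ⋃ n : ℕ, {ω | T ω ≤ ((n + 1 : ℕ) : ℕ∞)} :=
      measure_eq_zero_iff_ae_notMem.1 h0
    obtain ⟨ω, h2, h3⟩ := (h1.and h.ae_finite).exists
    lift T ω to ℕ using h3.ne with t ht
    exact h2 (Set.mem_iUnion.2 ⟨t, by
      simp only [Set.mem_ofPred_eq, ← ht]; exact_mod_cast t.le_succ⟩)
  refine ⟨n + 1, by omega, fun h0 => hn ?_⟩
  set A := {ω | T ω ≤ ((n + 1 : ℕ) : ℕ∞)}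
  have hA : MeasurableSet A :=
    h.measurable_time (MeasurableSet.of_discrete (s := {t | t ≤ ((n + 1 : ℕ) : ℕ∞)}))
  have hS : Measurable fun ω => S ω (n + 1) := (measurable_pi_apply _).comp h.left.measurable
  have hS' : Measurable fun ω => S' ω (n + 1) := (measurable_pi_apply _).comp h.right.measurable
  have h1 : (P.restrict A).map (fun ω => S ω (n + 1)) ≤ convPow μ (n + 1) := by
    rw [← leftShift_one (convPow μ (n + 1)), ← h.left.map_apply]
    exact map_mono restrict_le_self hS
  have h2 : (P.restrict A).map (fun ω => S ω (n + 1)) ≤ leftShift x (convPow μ (n + 1)) := by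
    rw [← h.right.map_apply, Measure.map_congr (g := fun ω => S' ω (n + 1))]
    · exact map_mono restrict_le_self hS'
    · filter_upwards [ae_restrict_mem hA] with ω hω using h.coupled ω (n + 1) hω
  -- Shifting by `x⁻¹` turns the two upper bounds μ^n and θ_x μ^n into θ_x⁻¹μ^n and μ^n.
  have h3 : leftShift x⁻¹ ((P.restrict A).map (fun ω => S ω (n + 1))) ≤ 0 := by
    rw [← h0]
    refine le_inf ?_ (leftShift_mono _ h1)
    calc _ ≤ _ := leftShift_mono x⁻¹ h2
      _ = _ := by rw [leftShift_leftShift, inv_mul_cancel, leftShift_one]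
  have h4 := h3 Set.univ
  rw [leftShift_univ, Measure.map_apply hS .univ] at h4
  simpa using h4

end Walk

/-! ### Exact coupling of two path laws -/

section Coupling

variable {E F : Type*} [MeasurableSpace E] [MeasurableSpace F]

/-- The density of `η` with respect to `a.map f` is at most 1; composed with `f`, it is the density
of `γ` with respect to `a`. -/
theorem exists_le_map_eq {a : Measure E} [IsFiniteMeasure a] {f : E → F} (hf : Measurable f)
    {η : Measure F} (h : η ≤ a.map f) : ∃ γ ≤ a, γ.map f = η := by
  have : IsFiniteMeasure η := isFiniteMeasure_of_le _ h
  have hd : Measurable (η.rnDeriv (a.map f)) := measurable_rnDeriv _ _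
  refine ⟨a.withDensity (η.rnDeriv (a.map f) ∘ f), ?_, ?_⟩
  · calc _ ≤ a.withDensity 1 :=
          withDensity_mono (ae_of_ae_map hf.aemeasurable (rnDeriv_le_one_of_le h))
      _ = a := withDensity_one
  · ext B hB
    rw [map_apply hf hB, withDensity_apply _ (hf hB)]
    conv_rhs => rw [← withDensity_rnDeriv_eq η (a.map f) (absolutelyContinuous_of_le h)]
    rw [withDensity_apply _ hB, setLIntegral_map hB hd hf]
    rfl

/-- The minimum `η` of the two images, read off a Hahn decomposition, lifts to parts of `a` and of
`b`. What remains of `a` has the mass by which `a.map f` exceeds `b.map f` on the Hahn set, and any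
valid `ε` bounds this. -/
theorem exists_common_part (a b : Measure E) [IsFiniteMeasure a] [IsFiniteMeasure b] {f : E → F}
    (hf : Measurable f) :
    ∃ γ γ' a' b' : Measure E, a = γ + a' ∧ b = γ' + b' ∧ γ.map f = γ'.map f ∧
      ∀ ε, DominatedUpTo ε (a.map f) (b.map f) → a' Set.univ ≤ ε := by
  obtain ⟨s, hs, h1, h2⟩ := hahn_decomposition (a.map f) (b.map f)
  set η := (b.map f).restrict s + (a.map f).restrict sᶜ with hη
  have e1 : (b.map f).restrict s ≤ (a.map f).restrict s := le_iff.2 fun t ht => by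
    rw [restrict_apply ht, restrict_apply ht]
    exact h1 _ (ht.inter hs) Set.inter_subset_right
  have e2 : (a.map f).restrict sᶜ ≤ (b.map f).restrict sᶜ := le_iff.2 fun t ht => by
    rw [restrict_apply ht, restrict_apply ht]
    exact h2 _ (ht.inter hs.compl) Set.inter_subset_right
  have ha : η ≤ a.map f := by
    conv_rhs => rw [← restrict_add_restrict_compl (μ := a.map f) hs]
    exact add_le_add e1 le_rfl
  have hb : η ≤ b.map f := by
    conv_rhs => rw [← restrict_add_restrict_compl (μ := b.map f) hs]
    exact add_le_add le_rfl e2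
  obtain ⟨γ, hγ, hγη⟩ := exists_le_map_eq hf ha
  obtain ⟨γ', hγ', hγη'⟩ := exists_le_map_eq hf hb
  have := isFiniteMeasure_of_le _ hγ
  have := isFiniteMeasure_of_le _ hγ'
  refine ⟨γ, γ', a - γ, b - γ', ?_, ?_, by rw [hγη, hγη'], fun ε hε => ?_⟩
  · rw [add_comm, sub_add_cancel_of_le hγ]
  · rw [add_comm, sub_add_cancel_of_le hγ']
  · have hu : ∀ c : Measure E, c Set.univ = c.map f Set.univ := fun c => by
      rw [map_apply hf .univ, Set.preimage_univ]
    rw [sub_apply .univ hγ, tsub_le_iff_right, hu γ, hγη, hu a, hη, add_apply,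
      restrict_apply .univ, restrict_apply .univ, Set.univ_inter, Set.univ_inter,
      ← measure_add_measure_compl hs, ← add_assoc]
    gcongr
    rw [add_comm]
    exact hε s hs

/-- Two finite measures with the same image under `f` can be coupled along `f`. -/
theorem exists_glue [StandardBorelSpace E] [Nonempty E] [MeasurableEq F] {γ γ' : Measure E}
    [IsFiniteMeasure γ] [IsFiniteMeasure γ'] {f : E → F} (hf : Measurable f)
    (h : γ.map f = γ'.map f) :
    ∃ Γ : Measure (E × E), Γ.map Prod.fst = γ ∧ Γ.map Prod.snd = γ' ∧
      ∀ᵐ p ∂Γ, f p.1 = f p.2 := by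
  -- The two points are drawn conditionally independently given the common value of `f`.
  set K := ProbabilityTheory.condDistrib id f γ
  set K' := ProbabilityTheory.condDistrib id f γ'
  have hK : γ.map f ⊗ₘ K = γ.map (fun e => (f e, e)) :=
    ProbabilityTheory.compProd_map_condDistrib measurable_id.aemeasurable
  have hK' : γ.map f ⊗ₘ K' = γ'.map (fun e => (f e, e)) := by
    rw [h]; exact ProbabilityTheory.compProd_map_condDistrib measurable_id.aemeasurable
  set ρ := γ.map f ⊗ₘ (ProbabilityTheory.Kernel.prod K K') with hR
  have h1 : ρ.map (Prod.map id Prod.fst) = γ.map (fun e => (f e, e)) := by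
    rw [hR, ← compProd_map measurable_fst, ← ProbabilityTheory.Kernel.fst_eq,
      ProbabilityTheory.Kernel.fst_prod, hK]
  have h2 : ρ.map (Prod.map id Prod.snd) = γ'.map (fun e => (f e, e)) := by
    rw [hR, ← compProd_map measurable_snd, ← ProbabilityTheory.Kernel.snd_eq,
      ProbabilityTheory.Kernel.snd_prod, hK']
  have hp : Measurable fun e => (f e, e) := hf.prodMk measurable_id
  have m1 : Measurable (Prod.map id Prod.fst : F × (E × E) → F × E) := by fun_prop
  have m2 : Measurable (Prod.map id Prod.snd : F × (E × E) → F × E) := by fun_prop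
  have hset : MeasurableSet {q : F × E | q.1 = f q.2} :=
    measurableSet_eq_fun measurable_fst (hf.comp measurable_snd)
  have q1 : ∀ᵐ r ∂ρ, r.1 = f r.2.1 := by
    refine (ae_map_iff (p := fun q : F × E => q.1 = f q.2) m1.aemeasurable hset).1 ?_
    rw [h1, ae_map_iff hp.aemeasurable hset]
    simp
  have q2 : ∀ᵐ r ∂ρ, r.1 = f r.2.2 := by
    refine (ae_map_iff (p := fun q : F × E => q.1 = f q.2) m2.aemeasurable hset).1 ?_
    rw [h2, ae_map_iff hp.aemeasurable hset]
    simp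
  refine ⟨ρ.map Prod.snd, ?_, ?_, ?_⟩
  · calc _ = (ρ.map (Prod.map id Prod.fst)).map Prod.snd := by
          rw [map_map measurable_fst measurable_snd, map_map measurable_snd m1]; rfl
      _ = γ := by rw [h1, map_map measurable_snd hp]; exact Measure.map_id
  · calc _ = (ρ.map (Prod.map id Prod.snd)).map Prod.snd := by
          rw [map_map measurable_snd measurable_snd, map_map measurable_snd m2]; rfl
      _ = γ' := by rw [h2, map_map measurable_snd hp]; exact Measure.map_id
  · refine (ae_map_iff (p := fun e : E × E => f e.1 = f e.2) measurable_snd.aemeasurable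
      (measurableSet_eq_fun (hf.comp measurable_fst) (hf.comp measurable_snd))).2 ?_
    filter_upwards [q1, q2] with r h3 h4 using h3.symm.trans h4

theorem sum_eq_of_tendsto_zero {γ a : ℕ → Measure E} (h : ∀ n, a n = γ n + a (n + 1))
    (h0 : Tendsto (fun n => a n Set.univ) atTop (𝓝 0)) : Measure.sum γ = a 0 := by
  ext B hB
  have hsum : ∀ n, ∑ k ∈ Finset.range n, γ k B + a n B = a 0 B := fun n => by
    induction n with
    | zero => simp
    | succ n ih => rw [← ih, h n, add_apply, Finset.sum_range_succ, add_assoc]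
  have hB0 : Tendsto (fun n => a n B) atTop (𝓝 0) :=
    tendsto_of_tendsto_of_tendsto_of_le_of_le tendsto_const_nhds h0 (fun _ => zero_le)
      fun n => measure_mono (Set.subset_univ B)
  have hlim := (ENNReal.summable (f := fun k => γ k B)).hasSum.tendsto_sum_nat.add hB0
  simp only [hsum, add_zero] at hlim
  rw [sum_apply _ hB]
  exact (tendsto_nhds_unique tendsto_const_nhds hlim).symm

/-- The path after time `k`. -/
def pathShift {X : Type*} (k : ℕ) (S : ℕ → X) : ℕ → X := fun n => S (n + k)

theorem measurable_pathShift {X : Type*} [MeasurableSpace X] (k : ℕ) :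
    Measurable (pathShift (X := X) k) :=
  measurable_pi_lambda _ fun n => measurable_pi_apply (n + k)

theorem map_pathShift_eq_of_le {X : Type*} [MeasurableSpace X] {a b : Measure (ℕ → X)} {k m : ℕ}
    (hkm : k ≤ m) (h : a.map (pathShift k) = b.map (pathShift k)) :
    a.map (pathShift m) = b.map (pathShift m) := by
  have : pathShift (X := X) m = pathShift (m - k) ∘ pathShift k := by
    funext S n
    simp only [pathShift, Function.comp_apply]
    congr 1; omega
  rw [this, ← map_map (measurable_pathShift _) (measurable_pathShift _), h,
    map_map (measurable_pathShift _) (measurable_pathShift _)]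

/-- Two path laws whose shifts by `n` differ by at most `ε n` split into parts `γ n`, `γ' n` that
agree after time `n`, with remainders of mass at most `ε n`. -/
theorem exists_path_splitting {X : Type*} [MeasurableSpace X] (P P' : Measure (ℕ → X))
    [IsProbabilityMeasure P] [IsProbabilityMeasure P'] {ε : ℕ → ℝ≥0∞}
    (hε : ∀ n, DominatedUpTo (ε n) (P.map (pathShift n)) (P'.map (pathShift n))) :
    ∃ γ γ' a b : ℕ → Measure (ℕ → X), a 0 = P ∧ b 0 = P' ∧
      (∀ n, a n = γ n + a (n + 1)) ∧ (∀ n, b n = γ' n + b (n + 1)) ∧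
      (∀ n, (γ n).map (pathShift n) = (γ' n).map (pathShift n)) ∧
      (∀ n, a (n + 1) Set.univ ≤ ε n) ∧ ∀ n, a n Set.univ = b n Set.univ := by
  let St := {p : Measure (ℕ → X) × Measure (ℕ → X) // IsFiniteMeasure p.1 ∧ IsFiniteMeasure p.2}
  have step : ∀ (n : ℕ) (p : St), ∃ (q : Measure (ℕ → X) × Measure (ℕ → X)) (r : St),
      p.1.1 = q.1 + r.1.1 ∧ p.1.2 = q.2 + r.1.2 ∧
      q.1.map (pathShift n) = q.2.map (pathShift n) ∧
      ∀ ε, DominatedUpTo ε (p.1.1.map (pathShift n)) (p.1.2.map (pathShift n)) →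
        r.1.1 Set.univ ≤ ε := by
    rintro n ⟨⟨a, b⟩, ha, hb⟩
    simp only at ha hb
    obtain ⟨γ, γ', a', b', h1, h2, h3, h4⟩ := exists_common_part a b (measurable_pathShift n)
    have ha' : IsFiniteMeasure a' := isFiniteMeasure_of_le a (h1 ▸ Measure.le_add_left le_rfl)
    have hb' : IsFiniteMeasure b' := isFiniteMeasure_of_le b (h2 ▸ Measure.le_add_left le_rfl)
    exact ⟨(γ, γ'), ⟨(a', b'), ha', hb'⟩, h1, h2, h3, h4⟩
  choose q nxt hq1 hq2 hq3 hq4 using step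
  let st : ℕ → St := fun n => Nat.rec ⟨(P, P'), inferInstance, inferInstance⟩ nxt n
  have ha : ∀ n, (st n).1.1 = (q n (st n)).1 + (st (n + 1)).1.1 := fun n => hq1 n (st n)
  have hb : ∀ n, (st n).1.2 = (q n (st n)).2 + (st (n + 1)).1.2 := fun n => hq2 n (st n)
  have hfin : ∀ n, IsFiniteMeasure (q n (st n)).1 := fun n =>
    have := (st n).2.1
    isFiniteMeasure_of_le (st n).1.1 (by conv_rhs => rw [ha n]
                                         exact Measure.le_add_right le_rfl)
  -- Parts peeled off up to time `n` agree after `n`, hence after `m`. They cancel, and the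
  -- remainders inherit the bound `ε m` of the original laws.
  have hdom : ∀ n m, n ≤ m →
      DominatedUpTo (ε m) ((st n).1.1.map (pathShift m)) ((st n).1.2.map (pathShift m)) := by
    intro n
    induction n with
    | zero => exact fun m _ => hε m
    | succ n ih =>
      intro m hm
      have h := ih m (by omega)
      have := hfin n
      rw [ha n, hb n, Measure.map_add _ _ (measurable_pathShift m),
        Measure.map_add _ _ (measurable_pathShift m),
        ← map_pathShift_eq_of_le (by omega) (hq3 n (st n))] at h
      exact h.of_add_left
  have hmass : ∀ n, (q n (st n)).1 Set.univ = (q n (st n)).2 Set.univ := fun n => by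
    have := congrArg (fun c => c Set.univ) (hq3 n (st n))
    simpa [map_apply (measurable_pathShift n) MeasurableSet.univ] using this
  refine ⟨fun n => (q n (st n)).1, fun n => (q n (st n)).2, fun n => (st n).1.1,
    fun n => (st n).1.2, rfl, rfl, ha, hb, fun n => hq3 n (st n),
    fun n => hq4 n (st n) _ (hdom n n le_rfl), fun n => ?_⟩
  induction n with
  | zero => simp [st]
  | succ n ih =>
    have := hfin n
    beta_reduce at ih ⊢
    rw [ha n, hb n, add_apply, add_apply, ← hmass n] at ih
    exact (ENNReal.add_right_inj (measure_ne_top _ _)).1 ih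

/-- Two path laws whose shifts converge to each other admit a successful exact coupling. -/
theorem exists_successful_path_coupling {X : Type u} [MeasurableSpace X] [StandardBorelSpace X]
    [Nonempty X] (P P' : Measure (ℕ → X)) [IsProbabilityMeasure P] [IsProbabilityMeasure P']
    {ε : ℕ → ℝ≥0∞} (hε0 : Tendsto ε atTop (𝓝 0))
    (hε : ∀ n, DominatedUpTo (ε n) (P.map (pathShift n)) (P'.map (pathShift n)))
    {n₀ : ℕ} (hn₀ : ε n₀ < 1) :
    ∃ (Ω : Type u) (_ : MeasurableSpace Ω) (Q : Measure Ω) (_ : IsProbabilityMeasure Q)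
      (S S' : Ω → ℕ → X) (T : Ω → ℕ∞), Measurable S ∧ Measurable S' ∧ Measurable T ∧
      Q.map S = P ∧ Q.map S' = P' ∧ (∀ (ω : Ω) (n : ℕ), T ω ≤ (n : ℕ∞) → S ω n = S' ω n) ∧
      (∀ᵐ ω ∂Q, T ω < ⊤) ∧ 0 < Q {ω | T ω = (n₀ : ℕ∞)} := by
  classical
  obtain ⟨γ, γ', a, b, ha0, hb0, ha, hb, hγ, haε, hab⟩ := exists_path_splitting P P' hε
  have hlim : Tendsto (fun n => a n Set.univ) atTop (𝓝 0) :=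
    (tendsto_add_atTop_iff_nat 1).1 (tendsto_of_tendsto_of_tendsto_of_le_of_le
      tendsto_const_nhds hε0 (fun _ => zero_le) haε)
  have hsγ : Measure.sum γ = P := by rw [sum_eq_of_tendsto_zero ha hlim, ha0]
  have hsγ' : Measure.sum γ' = P' := by
    rw [sum_eq_of_tendsto_zero hb (by simpa only [← hab] using hlim), hb0]
  have hfin : ∀ n, IsFiniteMeasure (γ n) := fun n =>
    isFiniteMeasure_of_le P (hsγ ▸ le_sum γ n)
  have hfin' : ∀ n, IsFiniteMeasure (γ' n) := fun n =>
    isFiniteMeasure_of_le P' (hsγ' ▸ le_sum γ' n)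
  choose Γ hΓ hΓ' hΓeq using fun n => exists_glue (measurable_pathShift n) (hγ n)
  -- The first coordinate records the time at which the pair was peeled off.
  let Q : Measure (ℕ × ((ℕ → X) × (ℕ → X))) := Measure.sum fun n => (Γ n).map (Prod.mk n)
  have hmk : ∀ n : ℕ, Measurable (Prod.mk n : (ℕ → X) × (ℕ → X) → _) :=
    fun n => measurable_prodMk_left
  have mS : Measurable fun ω : ℕ × ((ℕ → X) × (ℕ → X)) => ω.2.1 :=
    measurable_fst.comp measurable_snd
  have mS' : Measurable fun ω : ℕ × ((ℕ → X) × (ℕ → X)) => ω.2.2 :=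
    measurable_snd.comp measurable_snd
  have hQS : Q.map (fun ω => ω.2.1) = P := by
    rw [Measure.map_sum mS.aemeasurable, ← hsγ]
    congr 1; funext n
    rw [map_map mS (hmk n), ← hΓ n]; rfl
  have hQS' : Q.map (fun ω => ω.2.2) = P' := by
    rw [Measure.map_sum mS'.aemeasurable, ← hsγ']
    congr 1; funext n
    rw [map_map mS' (hmk n), ← hΓ' n]; rfl
  have hQ : IsProbabilityMeasure Q := ⟨by
    rw [← measure_univ (μ := P), ← hQS, map_apply mS .univ, Set.preimage_univ]⟩
  -- The value `⊤` off an almost sure event makes the agreement hold at every point. The maximum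
  -- with `n₀` collects all layers up to `n₀` in the event {T = n₀}.
  let T : ℕ × ((ℕ → X) × (ℕ → X)) → ℕ∞ := fun ω =>
    if pathShift ω.1 ω.2.1 = pathShift ω.1 ω.2.2 then ((max ω.1 n₀ : ℕ) : ℕ∞) else ⊤
  have mT : Measurable T := measurable_from_prod_countable_right fun n =>
    Measurable.ite (measurableSet_eq_fun ((measurable_pathShift n).comp measurable_fst)
      ((measurable_pathShift n).comp measurable_snd))
      (measurable_const (a := ((max n n₀ : ℕ) : ℕ∞))) measurable_const
  have hae : ∀ {p : ℕ × ((ℕ → X) × (ℕ → X)) → Prop}, MeasurableSet {ω | p ω} →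
      ((∀ᵐ ω ∂Q, p ω) ↔ ∀ n, ∀ᵐ e ∂(Γ n), p (n, e)) := fun hp => by
    rw [Measure.ae_sum_iff]
    exact forall_congr' fun n => ae_map_iff (hmk n).aemeasurable hp
  refine ⟨_, inferInstance, Q, hQ, fun ω => ω.2.1, fun ω => ω.2.2, T, mS, mS', mT, hQS, hQS',
    fun ω n hn => ?_, ?_, ?_⟩
  · by_cases h : pathShift ω.1 ω.2.1 = pathShift ω.1 ω.2.2
    · simp only [T, h, if_true, Nat.cast_le] at hn
      have h1 := congrFun h (n - ω.1)
      simpa only [pathShift, Nat.sub_add_cancel ((le_max_left _ _).trans hn)] using h1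
    · simp [T, h] at hn
  · rw [hae (p := fun ω => T ω < ⊤) (mT (MeasurableSet.of_discrete (s := {t : ℕ∞ | t < ⊤})))]
    intro n
    filter_upwards [hΓeq n] with e he
    simp only [T, he, if_true]
    exact WithTop.coe_lt_top _
  · rw [pos_iff_ne_zero]
    intro h0
    have h1 : ∀ᵐ ω ∂Q, T ω ≠ (n₀ : ℕ∞) := by simpa [ae_iff] using h0
    rw [hae (p := fun ω => T ω ≠ (n₀ : ℕ∞))
      (mT (MeasurableSet.of_discrete (s := {t : ℕ∞ | t ≠ n₀})))] at h1
    -- If {T = n₀} were null, nothing would be peeled off up to time `n₀`, leaving mass 1 against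
    -- the bound `ε n₀ < 1`.
    have hzero : ∀ n ≤ n₀, γ n = 0 := fun n hn => by
      have : ∀ᵐ e ∂(Γ n), False := by
        filter_upwards [h1 n, hΓeq n] with e h2 h3
        simp [T, h3, hn] at h2
      rw [← hΓ n, ae_eq_bot.1 (eventually_false_iff_eq_bot.1 this), Measure.map_zero]
    have hone : ∀ n ≤ n₀ + 1, a n = P := fun n => by
      induction n with
      | zero => exact fun _ => ha0
      | succ n ih => intro hn; rw [← ih (by omega), ha n, hzero n (by omega), zero_add]
    have := haε n₀
    rw [hone _ le_rfl, measure_univ] at this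
    exact this.not_gt hn₀

end Coupling

theorem exists_successful_exactCoupling {G : Type u} [Group G] [MeasurableSpace G]
    [StandardBorelSpace G] [MeasurableMul₂ G] (μ : Measure G) [IsProbabilityMeasure μ] (x : G)
    {ε : ℕ → ℝ≥0∞} (hε0 : Tendsto ε atTop (𝓝 0))
    (hε : ∀ n, DominatedUpTo (ε n) (convPow μ n) (leftShift x (convPow μ n)))
    {n₀ : ℕ} (hn₀ : convPow μ n₀ ⊓ leftShift x (convPow μ n₀) ≠ 0) :
    ∃ (Ω : Type u) (_ : MeasurableSpace Ω) (P : Measure Ω) (_ : IsProbabilityMeasure P)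
      (S S' : Ω → ℕ → G) (T : Ω → ℕ∞),
      IsSuccessfulExactCoupling P 1 x μ S S' T ∧ 0 < P {ω | T ω = (n₀ : ℕ∞)} := by
  classical
  obtain ⟨δ, hδ1, hδ⟩ := DominatedUpTo.of_inf_ne_zero hn₀
  -- The given `ε n₀` need not be below 1; the overlap at `n₀` supplies a `δ` that is, and changing
  -- one term keeps the limit.
  let ε' : ℕ → ℝ≥0∞ := fun n => if n = n₀ then δ else ε n
  have hε0' : Tendsto ε' atTop (𝓝 0) := hε0.congr' <| by
    filter_upwards [eventually_gt_atTop n₀] with n hn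
    simp [ε', hn.ne']
  have hε' : ∀ n, DominatedUpTo (ε' n) (convPow μ n) (leftShift x (convPow μ n)) := fun n => by
    by_cases h : n = n₀
    · subst h; simpa [ε'] using hδ
    · simpa [ε', h] using hε n
  have hshift : ∀ n, DominatedUpTo (ε' n) ((randomWalkLaw 1 μ).map (pathShift n))
      ((randomWalkLaw x μ).map (pathShift n)) := fun n => by
    have h1 := randomWalkLaw_map_shift μ 1 n
    have h2 := randomWalkLaw_map_shift μ x n
    rw [leftShift_one] at h1
    unfold pathShift
    rw [h1, h2]
    simpa [walkLaw] using ((hε' n).prod (infinitePi fun _ : ℕ => μ)).map measurable_walk_prod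
  obtain ⟨Ω, mΩ, Q, hQ, S, S', T, mS, mS', mT, hS, hS', hc, hfin, hpos⟩ :=
    exists_successful_path_coupling (randomWalkLaw 1 μ) (randomWalkLaw x μ) hε0' hshift
      (n₀ := n₀) (by simpa [ε'] using hδ1)
  exact ⟨Ω, mΩ, Q, hQ, S, S', T, ⟨⟨⟨mS, hS⟩, ⟨mS', hS'⟩, mT, hc⟩, hfin⟩, hpos⟩

/-! ### Binomial estimates -/

/-- This is the variance n/4 of Bin(n, 1/2), rescaled by 4 · 2^n. -/
theorem sum_choose_mul_sub_sq (n : ℕ) :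
    ∑ i ∈ Finset.range (n + 1), (n.choose i : ℝ) * ((n : ℝ) - 2 * i) ^ 2 =
      (n : ℝ) * 2 ^ n := by
  have h := congrArg (Polynomial.eval (1 / 2 : ℝ)) (bernsteinPolynomial.variance ℝ n)
  simp only [Polynomial.eval_finsetSum, bernsteinPolynomial, Polynomial.eval_mul,
    Polynomial.eval_pow, Polynomial.eval_sub, Polynomial.eval_X,
    Polynomial.eval_natCast, Polynomial.eval_one, nsmul_eq_mul] at h
  have h2 : ∀ i ∈ Finset.range (n + 1), (n.choose i : ℝ) * ((n : ℝ) - 2 * i) ^ 2 =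
      4 * 2 ^ n * (((n : ℝ) * (1 / 2) - i) ^ 2 *
        (n.choose i * (1 / 2) ^ i * (1 - 1 / 2) ^ (n - i))) := fun i hi => by
    have h3 : ((1 / 2 : ℝ)) ^ i * (1 - 1 / 2) ^ (n - i) = (2 ^ n)⁻¹ := by
      rw [show (1 - 1 / 2 : ℝ) = 1 / 2 by norm_num, ← pow_add,
        Nat.add_sub_cancel' (Nat.lt_succ_iff.1 (Finset.mem_range.1 hi)), one_div, inv_pow]
    rw [mul_assoc (n.choose i : ℝ), h3]
    field_simp
    ring
  rw [Finset.sum_congr rfl h2, ← Finset.mul_sum, h]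
  ring

theorem sum_choose_mul_abs_le (n : ℕ) :
    ∑ i ∈ Finset.range (n + 1), (n.choose i : ℝ) * |(n : ℝ) - 2 * i| ≤ 2 ^ n * √n := by
  have hcs := Finset.sum_sq_le_sum_mul_sum_of_sq_le_mul (Finset.range (n + 1))
    (f := fun i => (n.choose i : ℝ)) (g := fun i => (n.choose i : ℝ) * ((n : ℝ) - 2 * i) ^ 2)
    (r := fun i => (n.choose i : ℝ) * |(n : ℝ) - 2 * i|)
    (fun i _ => by positivity) (fun i _ => by positivity)
    (fun i _ => by rw [mul_pow, sq_abs]; exact le_of_eq (by ring))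
  rw [sum_choose_mul_sub_sq] at hcs
  have hs : ∑ i ∈ Finset.range (n + 1), (n.choose i : ℝ) = 2 ^ n := by
    exact_mod_cast Nat.sum_range_choose n
  rw [hs] at hcs
  refine abs_le_of_sq_le_sq' ?_ (by positivity) |>.2
  rw [mul_pow, Real.sq_sqrt (Nat.cast_nonneg n)]
  linarith [hcs]

/-- Binomial averages of a bounded sequence have differences of order `j ^ (-1/2)`. -/
theorem abs_sum_choose_mul_sub_le {φ : ℕ → ℝ} {M : ℝ} (hφ : ∀ i, |φ i| ≤ M) (j : ℕ) :
    |∑ m ∈ Finset.range (j + 1), (j.choose m : ℝ) * φ m -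
      ∑ m ∈ Finset.range (j + 1), (j.choose m : ℝ) * φ (m + 1)| ≤
      2 ^ j * M * (2 / √(j + 1)) := by
  have hM : 0 ≤ M := (abs_nonneg _).trans (hφ 0)
  -- After multiplication by `j + 1`, both sums live on row `j + 1` of Pascal's triangle, with
  -- weights `j + 1 - i` and `i`. Their difference `j + 1 - 2 * i` is the centred binomial
  -- deviation.
  have e1 : (j + 1 : ℝ) * ∑ m ∈ Finset.range (j + 1), (j.choose m : ℝ) * φ m =
      ∑ i ∈ Finset.range (j + 1 + 1), ((j + 1).choose i : ℝ) * ((j + 1 : ℝ) - i) * φ i := by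
    rw [Finset.sum_range_succ _ (j + 1), Finset.mul_sum]
    simp only [Nat.cast_add, Nat.cast_one, sub_self, mul_zero, zero_mul, add_zero]
    refine Finset.sum_congr rfl fun m hm => ?_
    have h1 : m ≤ j + 1 := (Finset.mem_range.1 hm).le
    have h2 : (j.choose m : ℝ) * (j + 1) = (j + 1).choose m * ((j + 1 : ℝ) - m) := by
      have := congrArg (Nat.cast (R := ℝ)) (Nat.choose_mul_succ_eq j m)
      push_cast [Nat.cast_sub h1] at this
      exact this
    rw [← h2]; ring
  have e2 : (j + 1 : ℝ) * ∑ m ∈ Finset.range (j + 1), (j.choose m : ℝ) * φ (m + 1) =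
      ∑ i ∈ Finset.range (j + 1 + 1), ((j + 1).choose i : ℝ) * i * φ i := by
    rw [Finset.sum_range_succ' _ (j + 1), Finset.mul_sum]
    simp only [Nat.cast_zero, mul_zero, zero_mul, add_zero]
    refine Finset.sum_congr rfl fun m _ => ?_
    have h2 : (j + 1 : ℝ) * j.choose m = (j + 1).choose (m + 1) * (m + 1) := by
      exact_mod_cast Nat.add_one_mul_choose_eq j m
    rw [Nat.cast_add, Nat.cast_one, ← h2]; ring
  have hj : (0 : ℝ) < j + 1 := by positivity
  have key : |(j + 1 : ℝ) * (∑ m ∈ Finset.range (j + 1), (j.choose m : ℝ) * φ m -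
      ∑ m ∈ Finset.range (j + 1), (j.choose m : ℝ) * φ (m + 1))| ≤
      M * (2 ^ (j + 1) * √(j + 1)) := by
    rw [mul_sub, e1, e2, ← Finset.sum_sub_distrib]
    calc _ ≤ ∑ i ∈ Finset.range (j + 1 + 1),
          |((j + 1).choose i : ℝ) * ((j + 1 : ℝ) - i) * φ i - ((j + 1).choose i : ℝ) * i * φ i| :=
          Finset.abs_sum_le_sum_abs _ _
      _ ≤ ∑ i ∈ Finset.range (j + 1 + 1),
          M * (((j + 1).choose i : ℝ) * |((j + 1 : ℕ) : ℝ) - 2 * i|) :=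
          Finset.sum_le_sum fun i _ => by
            have : ((j + 1).choose i : ℝ) * ((j + 1 : ℝ) - i) * φ i -
                ((j + 1).choose i : ℝ) * i * φ i =
                φ i * (((j + 1).choose i : ℝ) * (((j + 1 : ℕ) : ℝ) - 2 * i)) := by
              push_cast; ring
            rw [this, abs_mul, abs_mul, Nat.abs_cast]
            gcongr
            exact hφ i
      _ ≤ _ := by
          rw [← Finset.mul_sum]
          have := sum_choose_mul_abs_le (j + 1)
          push_cast at this ⊢
          gcongr
  rw [abs_mul, abs_of_pos hj] at key
  have hs : √(j + 1 : ℝ) * √(j + 1) = j + 1 := Real.mul_self_sqrt hj.le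
  have hs0 : 0 < √(j + 1 : ℝ) := Real.sqrt_pos.2 hj
  refine le_of_mul_le_mul_left (key.trans (le_of_eq ?_)) hj
  rw [pow_succ]
  field_simp
  rw [Real.sq_sqrt hj.le]

/-- The induction step for averaging over the number of coins: a coin appears with probability 2l.
Convexity of t ↦ t^{-1/2} is adverse to Jensen, so the mean increment 2l is weakened to l. With `a =
√t`, the bounds 1/√(t+1) ≤ (1 - 1/(4a²))/a and 1/√(t+l) ≥ (1 - l/(2a²))/a then match exactly. -/
theorem mix_inv_sqrt_le {t l : ℝ} (ht : 1 ≤ t) (hl : 0 ≤ l) (hl' : l ≤ 1 / 2) :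
    (1 - 2 * l) * (2 / √t) + 2 * l * (2 / √(t + 1)) ≤ 2 / √(t + l) := by
  obtain ⟨a, ha, rfl⟩ : ∃ a : ℝ, 1 ≤ a ∧ t = a ^ 2 :=
    ⟨√t, Real.one_le_sqrt.2 ht, (Real.sq_sqrt (by linarith)).symm⟩
  have ha0 : 0 < a := by linarith
  rw [Real.sqrt_sq ha0.le]
  set b := √(a ^ 2 + 1) with hb
  set r := √(a ^ 2 + l) with hr
  have hb2 : b ^ 2 = a ^ 2 + 1 := Real.sq_sqrt (by positivity)
  have hr2 : r ^ 2 = a ^ 2 + l := Real.sq_sqrt (by positivity)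
  have hb0 : 0 < b := Real.sqrt_pos.2 (by positivity)
  have hr0 : 0 < r := Real.sqrt_pos.2 (by positivity)
  have h1 : 1 / b ≤ 1 / a * (1 - 1 / (4 * a ^ 2)) := by
    have : a ≤ b * (1 - 1 / (4 * a ^ 2)) := by
      have hq : 1 / (4 * a ^ 2) ≤ 1 / 4 := by
        rw [div_le_div_iff₀ (by positivity) (by norm_num)]; nlinarith
      refine abs_le_of_sq_le_sq' ?_ (mul_nonneg hb0.le (by linarith)) |>.2
      rw [mul_pow, hb2]
      have hu : a ^ 2 * (1 / (4 * a ^ 2)) = 1 / 4 := by field_simp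
      have hu0 : 0 ≤ 1 / (4 * a ^ 2) := by positivity
      set u := 1 / (4 * a ^ 2)
      nlinarith
    rw [div_le_iff₀ hb0]
    calc (1 : ℝ) = 1 / a * a := by field_simp
      _ ≤ 1 / a * (b * (1 - 1 / (4 * a ^ 2))) := by gcongr
      _ = _ := by ring
  have h2 : 1 / a * (1 - l / (2 * a ^ 2)) ≤ 1 / r := by
    have h3 : r ≤ a + l / (2 * a) := by
      refine abs_le_of_sq_le_sq' ?_ (by positivity) |>.2
      rw [hr2]
      have : (a + l / (2 * a)) ^ 2 = a ^ 2 + l + (l / (2 * a)) ^ 2 := by field_simp; ring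
      rw [this]; nlinarith [sq_nonneg (l / (2 * a))]
    have h4 : 0 ≤ 1 - l / (2 * a ^ 2) := by
      rw [sub_nonneg, div_le_one (by positivity)]; nlinarith
    rw [le_div_iff₀ hr0]
    calc _ ≤ 1 / a * (1 - l / (2 * a ^ 2)) * (a + l / (2 * a)) := by gcongr
      _ = 1 - (l / (2 * a ^ 2)) ^ 2 := by field_simp; ring
      _ ≤ 1 := by nlinarith [sq_nonneg (l / (2 * a ^ 2))]
  calc _ = (1 - 2 * l) * (2 * (1 / a)) + 4 * l * (1 / b) := by ring
    _ ≤ (1 - 2 * l) * (2 * (1 / a)) + 4 * l * (1 / a * (1 - 1 / (4 * a ^ 2))) := by gcongr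
    _ = 2 * (1 / a * (1 - l / (2 * a ^ 2))) := by field_simp; ring
    _ ≤ 2 * (1 / r) := by gcongr
    _ = _ := by ring

/-! ### Decay of the discrepancy -/

section Decay

variable {G : Type u} [Group G] [MeasurableSpace G] [MeasurableMul₂ G]

theorem convPow_mul (a : Measure G) [IsFiniteMeasure a] (m n : ℕ) :
    convPow a (m * n) = convPow (convPow a m) n := by
  induction n with
  | zero => rw [mul_zero, convPow, convPow]
  | succ n ih => rw [mul_add, mul_one, convPow_add, ih, convPow]

theorem leftShift_mconv (x : G) (a b : Measure G) [SFinite a] [SFinite b] :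
    leftShift x (a ∗ₘ b) = leftShift x a ∗ₘ b := by
  have : SFinite (a ∗ₘ b) := by rw [mconv]; infer_instance
  rw [leftShift_eq_dirac_mconv, leftShift_eq_dirac_mconv, mconv_assoc]

theorem leftShift_mconv_of_comm {x : G} {a : Measure G} [SFinite a]
    (ha : a ∗ₘ dirac x = dirac x ∗ₘ a) (b : Measure G) [SFinite b] :
    leftShift x (a ∗ₘ b) = a ∗ₘ leftShift x b := by
  rw [leftShift_mconv, leftShift_eq_dirac_mconv, leftShift_eq_dirac_mconv, ← ha, mconv_assoc]

theorem leftShift_add (x : G) (a b : Measure G) :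
    leftShift x (a + b) = leftShift x a + leftShift x b :=
  Measure.map_add _ _ (measurable_const_mul x)

/-- Further steps act on the right and commute with the left shift, so they cannot increase the
discrepancy. Bounds along multiples of a fixed time therefore suffice. -/
theorem DominatedUpTo.convPow_of_le {μ : Measure G} [IsProbabilityMeasure μ] {x : G} {ε : ℝ≥0∞}
    {m n : ℕ} (hmn : m ≤ n) (h : DominatedUpTo ε (convPow μ m) (leftShift x (convPow μ m))) :
    DominatedUpTo ε (convPow μ n) (leftShift x (convPow μ n)) := by
  obtain ⟨k, rfl⟩ := Nat.exists_eq_add_of_le hmn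
  rw [convPow_add, leftShift_mconv]
  simpa using h.mconv (convPow μ k)

/-- The `i` factors `x` are distributed among the `m` factors `a`, at most one to each; both `a` and
its shift lie below `ν`. -/
theorem leftShift_pow_convPow_le {x : G} {a ν : Measure G} [IsFiniteMeasure a] [IsFiniteMeasure ν]
    (hx : a ∗ₘ dirac x = dirac x ∗ₘ a) (h : a ≤ ν) (h' : leftShift x a ≤ ν) {i m : ℕ}
    (hi : i ≤ m) : leftShift (x ^ i) (convPow a m) ≤ convPow ν m := by
  induction m generalizing i with
  | zero =>
    obtain rfl : i = 0 := by omega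
    rw [pow_zero, leftShift_one, convPow, convPow]
  | succ m ih =>
    rw [convPow, convPow]
    rcases Nat.le_succ_iff.1 hi with h1 | rfl
    · rw [leftShift_mconv]
      exact mconv_mono (ih h1) h
    · rw [pow_succ, ← leftShift_leftShift, leftShift_mconv_of_comm (mconv_dirac_comm_convPow hx m),
        leftShift_mconv]
      exact mconv_mono (ih le_rfl) h'

theorem exists_invariant_le_convPow {x : G} (hfin : IsOfFinOrder x) {a ν : Measure G}
    [IsFiniteMeasure a] [IsFiniteMeasure ν] (hx : a ∗ₘ dirac x = dirac x ∗ₘ a)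
    (h : a ≤ ν) (h' : leftShift x a ≤ ν) (ha : a ≠ 0) :
    ∃ U ≤ convPow ν (orderOf x), leftShift x U = U ∧ U Set.univ ≠ 0 := by
  set d := orderOf x with hd
  have hd0 : 0 < d := hfin.orderOf_pos
  have hdne : (d : ℝ≥0∞) ≠ 0 := by exact_mod_cast hd0.ne'
  let V : Measure G := ∑ i ∈ Finset.range d, leftShift (x ^ i) (convPow a d)
  have hVx : leftShift x V = V := by
    have h1 : leftShift x V = ∑ i ∈ Finset.range d, leftShift (x ^ (i + 1)) (convPow a d) := by
      have := map_sum (Measure.mapₗ (fun g : G => x * g))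
        (fun i => leftShift (x ^ i) (convPow a d)) (Finset.range d)
      simp only [Measure.mapₗ_apply_of_measurable (measurable_const_mul x)] at this
      rw [leftShift, this]
      refine Finset.sum_congr rfl fun i _ => ?_
      rw [pow_succ', ← leftShift_leftShift]
      rfl
    -- The sum over exponents 0, …, d is split at either end; since `x ^ d = 1` the end terms
    -- coincide and cancel.
    have h2 := Finset.sum_range_succ' (fun i => leftShift (x ^ i) (convPow a d)) d
    rw [Finset.sum_range_succ, hd, pow_orderOf_eq_one, pow_zero, ← hd] at h2
    rw [h1]
    ext B hB
    have h3 := congrArg (fun c => c B) h2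
    simp only [add_apply] at h3
    exact ((ENNReal.add_left_inj (measure_ne_top _ B)).1 h3).symm
  refine ⟨(d : ℝ≥0∞)⁻¹ • V, ?_, ?_, ?_⟩
  · have : V ≤ (d : ℝ≥0∞) • convPow ν d := by
      calc V ≤ ∑ i ∈ Finset.range d, convPow ν d := Finset.sum_le_sum fun i hi =>
            leftShift_pow_convPow_le hx h h' (Finset.mem_range.1 hi).le
        _ = _ := by rw [Finset.sum_const, Finset.card_range, Nat.cast_smul_eq_nsmul]
    calc _ ≤ (d : ℝ≥0∞)⁻¹ • ((d : ℝ≥0∞) • convPow ν d) := by gcongr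
      _ = _ := by rw [smul_smul, ENNReal.inv_mul_cancel hdne (ENNReal.natCast_ne_top d), one_smul]
  · rw [leftShift, Measure.map_smul]
    congr 1
  · have hV : V Set.univ = d * a Set.univ ^ d := by
      simp [V, Measure.finsetSum_apply, leftShift_univ, convPow_univ]
    rw [Measure.smul_apply, hV, smul_eq_mul, ← mul_assoc,
      ENNReal.inv_mul_cancel hdne (ENNReal.natCast_ne_top d), one_mul]
    exact pow_ne_zero _ (by simpa using ha)

/-- If the last factor is taken from `U`, it absorbs the shift; only the part `ν - U` passes the
discrepancy on. -/
theorem dominatedUpTo_convPow_of_invariant_le {x : G} {ν U : Measure G} [IsProbabilityMeasure ν]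
    (hx : ν ∗ₘ dirac x = dirac x ∗ₘ ν) (hU : U ≤ ν) (hUx : leftShift x U = U) (k : ℕ) :
    DominatedUpTo ((1 - U Set.univ) ^ k) (convPow ν k) (leftShift x (convPow ν k)) := by
  have : IsFiniteMeasure U := isFiniteMeasure_of_le ν hU
  have hν : U + (ν - U) = ν := by rw [add_comm, sub_add_cancel_of_le hU]
  have hmass : (ν - U) Set.univ = 1 - U Set.univ := by
    rw [sub_apply .univ hU, measure_univ]
  induction k with
  | zero =>
    intro B _
    rw [convPow, pow_zero]
    exact le_add_left prob_le_one
  | succ k ih =>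
    have e : convPow ν (k + 1) = convPow ν k ∗ₘ U + convPow ν k ∗ₘ (ν - U) := by
      rw [← mconv_add, hν, convPow]
    rw [e, leftShift_add, leftShift_mconv_of_comm (mconv_dirac_comm_convPow hx k), hUx,
      leftShift_mconv, pow_succ, ← hmass]
    rw [← hmass] at ih
    exact (ih.mconv (ν - U)).add_left _

/-- The sum of `a` and its left shift by `x`. -/
noncomputable def addShift (x : G) (a : Measure G) : Measure G := a + leftShift x a

instance (x : G) (a : Measure G) [IsFiniteMeasure a] : IsFiniteMeasure (addShift x a) := by
  rw [addShift]; infer_instance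

instance (x : G) (a : Measure G) [IsFiniteMeasure a] (j : ℕ) :
    IsFiniteMeasure ((addShift x)^[j] a) := by
  induction j with
  | zero => exact ‹_›
  | succ j ih => rw [Function.iterate_succ_apply']; infer_instance

theorem addShift_iterate_add (x : G) (a b : Measure G) (j : ℕ) :
    (addShift x)^[j] (a + b) = (addShift x)^[j] a + (addShift x)^[j] b := by
  induction j with
  | zero => rfl
  | succ j ih =>
    rw [Function.iterate_succ_apply', Function.iterate_succ_apply', Function.iterate_succ_apply',
      ih]
    simp only [addShift, leftShift_add]
    exact add_add_add_comm _ _ _ _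

theorem addShift_iterate_leftShift (x : G) (a : Measure G) (j : ℕ) :
    (addShift x)^[j] (leftShift x a) = leftShift x ((addShift x)^[j] a) :=
  (Function.Commute.iterate_left (f := addShift x) (g := leftShift x)
    (fun a => by simp only [addShift, leftShift_add]) j) a

theorem addShift_mconv (x : G) (a b : Measure G) [SFinite a] [SFinite b] :
    addShift x (a ∗ₘ b) = addShift x a ∗ₘ b := by
  have : SFinite (leftShift x a) := by rw [leftShift]; infer_instance
  rw [addShift, addShift, add_mconv, leftShift_mconv]

theorem addShift_iterate_real (x : G) (a : Measure G) [IsFiniteMeasure a] (j : ℕ) (B : Set G) :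
    ((addShift x)^[j] a).real B =
      ∑ m ∈ Finset.range (j + 1), (j.choose m : ℝ) * (leftShift (x ^ m) a).real B := by
  induction j generalizing a with
  | zero => simp [leftShift_one]
  | succ j ih =>
    rw [Function.iterate_succ_apply, ih, addShift]
    have h1 : ∀ m, (leftShift (x ^ m) (a + leftShift x a)).real B =
        (leftShift (x ^ m) a).real B + (leftShift (x ^ (m + 1)) a).real B := fun m => by
      rw [leftShift_add, leftShift_leftShift, ← pow_succ, measureReal_add_apply]
    simp only [h1, mul_add, Finset.sum_add_distrib]
    rw [Finset.sum_range_succ' _ (j + 1)]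
    simp only [Nat.choose_succ_succ, Nat.cast_add, add_mul, Finset.sum_add_distrib]
    rw [Finset.sum_range_succ' _ j, Finset.sum_range_succ (fun m => (j.choose (m + 1) : ℝ) * _) j]
    simp
    ring

/-- Here `j` counts the coins already extracted and `k` the factors `ν` still unexpanded. Expanding
one of them either keeps `j` (part `κ`, mass 1 - 2l) or raises it by one (mass l, with 2^j doubled).
With `k = 0` this is the binomial estimate, and `mix_inv_sqrt_le` closes the induction. -/
theorem abs_addShift_iterate_sub_le {x : G} {l : ℝ} {lam κ ν : Measure G} [IsFiniteMeasure lam]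
    [IsFiniteMeasure κ] [IsProbabilityMeasure ν] (hν : ν = κ + addShift x lam)
    (hxκ : κ ∗ₘ dirac x = dirac x ∗ₘ κ)
    (hxl : lam ∗ₘ dirac x = dirac x ∗ₘ lam) (hl : lam.real Set.univ = l) (B : Set G)
    (k j : ℕ) (a : Measure G) [IsFiniteMeasure a] (hxa : a ∗ₘ dirac x = dirac x ∗ₘ a) :
    |((addShift x)^[j] (a ∗ₘ convPow ν k)).real B -
      (leftShift x ((addShift x)^[j] (a ∗ₘ convPow ν k))).real B| ≤
      2 ^ j * a.real Set.univ * (2 / √(l * k + j + 1)) := by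
  have hl0 : 0 ≤ l := hl ▸ measureReal_nonneg
  have hmass : κ.real Set.univ = 1 - 2 * l := by
    have h1 : ν.real Set.univ = 1 := by simp
    have h2 : (leftShift x lam).real Set.univ = l := by
      rw [← hl, measureReal_def, leftShift_univ, measureReal_def]
    rw [hν, addShift, measureReal_add_apply, measureReal_add_apply, h2, hl] at h1
    linarith
  have hl' : l ≤ 1 / 2 := by
    have : 0 ≤ κ.real Set.univ := measureReal_nonneg
    linarith
  induction k generalizing j a with
  | zero =>
    rw [convPow, mconv_dirac_one, ← addShift_iterate_leftShift, addShift_iterate_real,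
      addShift_iterate_real]
    simp only [leftShift_leftShift, ← pow_succ, Nat.cast_zero, mul_zero, zero_add]
    refine abs_sum_choose_mul_sub_le (φ := fun m => (leftShift (x ^ m) a).real B) (fun i => ?_) j
    rw [abs_of_nonneg measureReal_nonneg]
    refine (measureReal_mono (Set.subset_univ B)).trans_eq ?_
    rw [measureReal_def, leftShift_univ, measureReal_def]
  | succ k ih =>
    have : IsFiniteMeasure (a ∗ₘ κ) := by rw [mconv]; infer_instance
    have : IsFiniteMeasure (a ∗ₘ lam) := by rw [mconv]; infer_instance
    have f1 : IsFiniteMeasure ((a ∗ₘ κ) ∗ₘ convPow ν k) := by rw [mconv]; infer_instance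
    have f2 : IsFiniteMeasure ((a ∗ₘ lam) ∗ₘ convPow ν k) := by rw [mconv]; infer_instance
    have e1 : a ∗ₘ ν = a ∗ₘ κ + addShift x (a ∗ₘ lam) := by
      rw [hν, mconv_add, addShift, mconv_add, addShift, leftShift_mconv_of_comm hxa]
    have e2 : (addShift x)^[j] (a ∗ₘ convPow ν (k + 1)) =
        (addShift x)^[j] ((a ∗ₘ κ) ∗ₘ convPow ν k) +
          (addShift x)^[j + 1] ((a ∗ₘ lam) ∗ₘ convPow ν k) := by
      have h1 : convPow ν (k + 1) = ν ∗ₘ convPow ν k := by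
        rw [add_comm, convPow_add]
        congr 1
        rw [convPow, convPow, dirac_one_mconv]
      rw [h1, ← mconv_assoc, e1, add_mconv, ← addShift_mconv, addShift_iterate_add,
        Function.iterate_succ_apply]
    have i1 := ih j (a ∗ₘ κ) (mconv_dirac_comm_mconv hxa hxκ)
    have i2 := ih (j + 1) (a ∗ₘ lam) (mconv_dirac_comm_mconv hxa hxl)
    have m1 : (a ∗ₘ κ).real Set.univ = a.real Set.univ * (1 - 2 * l) := by
      rw [measureReal_def, mconv_univ, ENNReal.toReal_mul, ← hmass]; rfl
    have m2 : (a ∗ₘ lam).real Set.univ = a.real Set.univ * l := by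
      rw [measureReal_def, mconv_univ, ENNReal.toReal_mul, ← hl]; rfl
    rw [m1] at i1
    rw [m2] at i2
    rw [e2, leftShift_add, measureReal_add_apply, measureReal_add_apply]
    have hkl : 0 ≤ l * k := by positivity
    have hmix := mix_inv_sqrt_le (t := l * k + j + 1) (by linarith [Nat.cast_nonneg (α := ℝ) j])
      hl0 hl'
    have ha : 0 ≤ 2 ^ j * a.real Set.univ := mul_nonneg (by positivity) measureReal_nonneg
    calc _ = |(((addShift x)^[j] ((a ∗ₘ κ) ∗ₘ convPow ν k)).real B -
          (leftShift x ((addShift x)^[j] ((a ∗ₘ κ) ∗ₘ convPow ν k))).real B) +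
          (((addShift x)^[j + 1] ((a ∗ₘ lam) ∗ₘ convPow ν k)).real B -
          (leftShift x ((addShift x)^[j + 1] ((a ∗ₘ lam) ∗ₘ convPow ν k))).real B)| := by
          congr 1; ring
      _ ≤ _ := (abs_add_le _ _).trans (add_le_add i1 i2)
      _ = 2 ^ j * a.real Set.univ * ((1 - 2 * l) * (2 / √(l * k + j + 1)) +
          2 * l * (2 / √(l * k + j + 1 + 1))) := by push_cast; rw [← add_assoc]; ring
      _ ≤ 2 ^ j * a.real Set.univ * (2 / √(l * k + j + 1 + l)) := by gcongr
      _ = _ := by congr 3; push_cast; ring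

theorem dominatedUpTo_convPow_sqrt {x : G} {lam κ ν : Measure G} [IsFiniteMeasure lam]
    [IsFiniteMeasure κ] [IsProbabilityMeasure ν] (hν : ν = κ + addShift x lam)
    (hxκ : κ ∗ₘ dirac x = dirac x ∗ₘ κ)
    (hxl : lam ∗ₘ dirac x = dirac x ∗ₘ lam) (k : ℕ) :
    DominatedUpTo (ENNReal.ofReal (2 / √(lam.real Set.univ * k + 1))) (convPow ν k)
      (leftShift x (convPow ν k)) := fun B _ => by
  have h := abs_addShift_iterate_sub_le hν hxκ hxl rfl B k 0 (dirac 1)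
    (by rw [dirac_one_mconv, mconv_dirac_one])
  rw [dirac_one_mconv, Function.iterate_zero_apply] at h
  have h0 : 0 ≤ 2 / √(lam.real Set.univ * k + 1) := by positivity
  simp only [pow_zero, one_mul, probReal_univ, Nat.cast_zero, add_zero] at h
  rw [← ofReal_measureReal (measure_ne_top _ B), ← ofReal_measureReal (measure_ne_top _ B),
    ← ENNReal.ofReal_add measureReal_nonneg h0]
  exact ENNReal.ofReal_le_ofReal (by linarith [(abs_le.1 h).2])

end Decay

/-! ### From overlap to explicit rates -/

section Overlap

variable {G : Type u} [Group G] [MeasurableSpace G] [MeasurableMul₂ G]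

theorem leftShift_inf_le (x : G) (ν : Measure G) : leftShift x (ν ⊓ leftShift x⁻¹ ν) ≤ ν := by
  calc _ ≤ leftShift x (leftShift x⁻¹ ν) := leftShift_mono x inf_le_right
    _ = ν := by rw [leftShift_leftShift, mul_inv_cancel, leftShift_one]

theorem leftShift_ne_zero {x : G} {a : Measure G} (ha : a ≠ 0) : leftShift x a ≠ 0 := fun h => by
  have := leftShift_univ x a
  rw [h] at this
  exact ha (by simpa using this.symm)

theorem inf_leftShift_ne_zero {x : G} {ν : Measure G} (h : ν ⊓ leftShift x⁻¹ ν ≠ 0) :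
    ν ⊓ leftShift x ν ≠ 0 := fun h0 => leftShift_ne_zero (x := x) h <| by
  have h1 : leftShift x (ν ⊓ leftShift x⁻¹ ν) ≤ ν ⊓ leftShift x ν :=
    le_inf (leftShift_inf_le x ν) (leftShift_mono x inf_le_left)
  rw [h0] at h1
  exact le_antisymm h1 (Measure.zero_le _)

/-- Half of the overlap and half of its shift each fit below ν/2, so together they fit below ν. -/
theorem exists_overlap_splitting {x : G} {ν : Measure G} [IsProbabilityMeasure ν]
    (hν : ν ⊓ leftShift x⁻¹ ν ≠ 0) :
    ∃ lam ≤ ν, ∃ κ ≤ ν, ν = κ + addShift x lam ∧ 0 < lam.real Set.univ := by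
  set c := ν ⊓ leftShift x⁻¹ ν with hc
  have hcν : c ≤ ν := inf_le_left
  have : IsFiniteMeasure c := isFiniteMeasure_of_le ν hcν
  have hhalf : ∀ a : Measure G, (2⁻¹ : ℝ≥0∞) • a + (2⁻¹ : ℝ≥0∞) • a = a := fun a => by
    rw [← add_smul, ENNReal.inv_two_add_inv_two, one_smul]
  have hlam : (2⁻¹ : ℝ≥0∞) • c ≤ c := by
    conv_rhs => rw [← hhalf c]
    exact Measure.le_add_left le_rfl
  have hadd : addShift x ((2⁻¹ : ℝ≥0∞) • c) ≤ ν := by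
    have h1 : leftShift x ((2⁻¹ : ℝ≥0∞) • c) = (2⁻¹ : ℝ≥0∞) • leftShift x c := by
      rw [leftShift, Measure.map_smul]; rfl
    rw [addShift, h1, ← hhalf ν]
    refine add_le_add ?_ ?_
    · gcongr
    · gcongr; exact leftShift_inf_le x ν
  have : IsFiniteMeasure (addShift x ((2⁻¹ : ℝ≥0∞) • c)) := isFiniteMeasure_of_le ν hadd
  refine ⟨_, hlam.trans hcν, ν - addShift x ((2⁻¹ : ℝ≥0∞) • c), Measure.sub_le,
    (sub_add_cancel_of_le hadd).symm, ?_⟩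
  rw [measureReal_def, ENNReal.toReal_pos_iff, Measure.smul_apply, smul_eq_mul]
  refine ⟨ENNReal.mul_pos (by simp) (by simpa using hν), by finiteness⟩

theorem exists_sqrt_bound {x : G} {μ : Measure G} [IsProbabilityMeasure μ] {n₀ : ℕ}
    (hn₀ : 1 ≤ n₀)
    (hinf : convPow μ n₀ ⊓ leftShift x⁻¹ (convPow μ n₀) ≠ 0)
    (hcomm : ∀ᵐ g ∂(convPow μ n₀), x * g = g * x) :
    ∃ r : ℕ → ℝ, (∀ n, 0 ≤ r n) ∧ Tendsto r atTop (𝓝 0) ∧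
      (∀ n, DominatedUpTo (ENNReal.ofReal (r n)) (convPow μ n) (leftShift x (convPow μ n))) ∧
      ∃ C : ℝ, 0 < C ∧ ∀ n : ℕ, 1 ≤ n → r n ≤ C / √n := by
  obtain ⟨lam, hlam, κ, hκ, hsplit, hpos⟩ := exists_overlap_splitting hinf
  have := isFiniteMeasure_of_le _ hlam
  have := isFiniteMeasure_of_le _ hκ
  set l := lam.real Set.univ
  have hl1 : l ≤ 1 := by
    have : lam.real Set.univ ≤ (convPow μ n₀).real Set.univ :=
      ENNReal.toReal_mono (measure_ne_top _ _) (hlam _)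
    simpa using this
  have hdom := dominatedUpTo_convPow_sqrt hsplit
    (mconv_dirac_comm_of_ae (hcomm.filter_mono (ae_mono hκ)))
    (mconv_dirac_comm_of_ae (hcomm.filter_mono (ae_mono hlam)))
  refine ⟨fun n => 2 / √(l * (n / n₀ : ℕ) + 1), fun n => by positivity, ?_, fun n => ?_,
    2 / √(l / n₀), by positivity, fun n hn => ?_⟩
  · refine Tendsto.div_atTop tendsto_const_nhds (Real.tendsto_sqrt_atTop.comp
      (tendsto_atTop_add_const_right _ _ (Tendsto.const_mul_atTop hpos
        (tendsto_natCast_atTop_atTop.comp (Nat.tendsto_div_const_atTop (by omega))))))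
  · refine DominatedUpTo.convPow_of_le (Nat.mul_div_le n n₀) ?_
    rw [convPow_mul]
    exact hdom (n / n₀)
  · have hn₀' : (0 : ℝ) < n₀ := by exact_mod_cast hn₀
    have hn' : (0 : ℝ) < n := by exact_mod_cast hn
    beta_reduce
    rw [div_div, ← Real.sqrt_mul (by positivity)]
    refine div_le_div_of_nonneg_left (by norm_num) (Real.sqrt_pos.2 (by positivity))
      (Real.sqrt_le_sqrt ?_)
    -- Rounding `n / n₀` down loses at most `l` under the root, which the summand 1 covers because
    -- `l ≤ 1`.
    have h1 : (n : ℝ) ≤ n₀ * ((n / n₀ : ℕ) + 1) := by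
      exact_mod_cast (Nat.lt_mul_div_succ n hn₀).le
    calc l / n₀ * n ≤ l / n₀ * (n₀ * ((n / n₀ : ℕ) + 1)) := by gcongr
      _ = l * (n / n₀ : ℕ) + l := by field_simp
      _ ≤ l * (n / n₀ : ℕ) + 1 := by linarith

theorem exists_geometric_bound {x : G} (hfin : IsOfFinOrder x) {μ : Measure G}
    [IsProbabilityMeasure μ] {n₀ : ℕ} (hn₀ : 1 ≤ n₀)
    (hinf : convPow μ n₀ ⊓ leftShift x⁻¹ (convPow μ n₀) ≠ 0)
    (hcomm : ∀ᵐ g ∂(convPow μ n₀), x * g = g * x) :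
    ∃ C ρ : ℝ, 0 < C ∧ 0 < ρ ∧ ρ < 1 ∧ ∀ n,
      DominatedUpTo (ENNReal.ofReal (C * ρ ^ n)) (convPow μ n) (leftShift x (convPow μ n)) := by
  set ν := convPow μ n₀ with hν
  have hle : ν ⊓ leftShift x⁻¹ ν ≤ ν := inf_le_left
  have := isFiniteMeasure_of_le _ hle
  obtain ⟨U, hU, hUx, hU0⟩ := exists_invariant_le_convPow hfin
    (mconv_dirac_comm_of_ae (hcomm.filter_mono (ae_mono hle))) hle (leftShift_inf_le x ν) hinf
  have := isFiniteMeasure_of_le _ hU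
  set d := orderOf x
  have hN : 0 < n₀ * d := Nat.mul_pos hn₀ hfin.orderOf_pos
  have hdom := dominatedUpTo_convPow_of_invariant_le
    (mconv_dirac_comm_convPow (mconv_dirac_comm_of_ae hcomm) d) hU hUx
  set w := U.real Set.univ with hw
  have hw0 : 0 < w := ENNReal.toReal_pos hU0 (measure_ne_top _ _)
  have hw1 : w ≤ 1 := by
    have : U.real Set.univ ≤ (convPow ν d).real Set.univ :=
      ENNReal.toReal_mono (measure_ne_top _ _) (hU _)
    simpa using this
  -- Halving `w` keeps `q` positive even when `w = 1`.
  obtain ⟨q, hq0, hq1, hwq⟩ : ∃ q : ℝ, 0 < q ∧ q < 1 ∧ 1 - w ≤ q :=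
    ⟨1 - w / 2, by linarith, by linarith, by linarith⟩
  have hN' : (0 : ℝ) < (n₀ * d : ℕ) := by exact_mod_cast hN
  -- The rate is `q` per block of `n₀ * d` steps, and the constant `q⁻¹` pays for rounding the
  -- number of blocks down.
  refine ⟨q⁻¹, q ^ (((n₀ * d : ℕ) : ℝ)⁻¹), by positivity, by positivity,
    Real.rpow_lt_one hq0.le hq1 (by positivity), fun n => ?_⟩
  refine DominatedUpTo.convPow_of_le (Nat.mul_div_le n (n₀ * d)) ?_
  rw [convPow_mul, convPow_mul]
  refine (hdom (n / (n₀ * d))).mono ?_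
  have h1 : 1 - U Set.univ ≤ ENNReal.ofReal q := by
    rw [← ofReal_measureReal (measure_ne_top U Set.univ), ← ENNReal.ofReal_one,
      ← ENNReal.ofReal_sub _ measureReal_nonneg]
    exact ENNReal.ofReal_le_ofReal hwq
  calc (1 - U Set.univ) ^ (n / (n₀ * d)) ≤ ENNReal.ofReal q ^ (n / (n₀ * d)) := by gcongr
    _ = ENNReal.ofReal (q ^ (n / (n₀ * d))) := (ENNReal.ofReal_pow hq0.le _).symm
    _ ≤ _ := by
      refine ENNReal.ofReal_le_ofReal ?_
      rw [← Real.rpow_mul_natCast hq0.le, ← Real.rpow_neg_one, ← Real.rpow_add hq0,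
        ← Real.rpow_natCast]
      refine Real.rpow_le_rpow_of_exponent_ge hq0 hq1.le ?_
      have h2 : (n : ℝ) ≤ (n₀ * d : ℕ) * ((n / (n₀ * d) : ℕ) + 1) := by
        exact_mod_cast (Nat.lt_mul_div_succ n hN).le
      have h3 : ((n₀ * d : ℕ) : ℝ)⁻¹ * n ≤ (n / (n₀ * d) : ℕ) + 1 := by
        rw [inv_mul_le_iff₀ hN']; exact h2
      linarith

theorem IsRandomWalk.totalVariation_le {μ : Measure G} [IsProbabilityMeasure μ] {x : G}
    {Ω : Type v} [MeasurableSpace Ω] {P : Measure Ω} [IsProbabilityMeasure P] {S S' : Ω → ℕ → G}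
    (h : IsRandomWalk P 1 μ S) (h' : IsRandomWalk P x μ S') {n : ℕ} {r : ℝ} (hr : 0 ≤ r)
    (hd : DominatedUpTo (ENNReal.ofReal r) (convPow μ n) (leftShift x (convPow μ n))) :
    totalVariation ((P.map (fun ω => S ω n)).toSignedMeasure -
      (P.map (fun ω => S' ω n)).toSignedMeasure) ≤ 2 * r := by
  have e := h.map_apply n
  rw [leftShift_one] at e
  simp only [e, h'.map_apply n]
  exact hd.totalVariation_le hr

end Overlap

end ExactCoupling

/-! ### The theorem -/

theorem mainTheorem2 {G : Type u} [Group G] [TopologicalSpace G] [IsTopologicalGroup G]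
    [PolishSpace G] [MeasurableSpace G] [BorelSpace G]
    (μ : Measure G) [IsProbabilityMeasure μ] (x : G) :
    (x ∈ ExactCoupling.successfulCouplingSet μ →
      ∃ n : ℕ, 1 ≤ n ∧
        ExactCoupling.convPow μ n ⊓
          ExactCoupling.leftShift x⁻¹ (ExactCoupling.convPow μ n) ≠ 0) ∧
    (∀ n₀ : ℕ, 1 ≤ n₀ →
      ExactCoupling.convPow μ n₀ ⊓
        ExactCoupling.leftShift x⁻¹ (ExactCoupling.convPow μ n₀) ≠ 0 →
      (∃ B : Set G, MeasurableSet B ∧ ExactCoupling.convPow μ n₀ B = 1 ∧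
        ∀ b ∈ B, x * b = b * x) →
      x ∈ ExactCoupling.successfulCouplingSet μ ∧
      (∃ (Ω : Type u) (_ : MeasurableSpace Ω) (P : Measure Ω) (_ : IsProbabilityMeasure P)
        (S S' : Ω → ℕ → G) (T : Ω → ℕ∞),
        ExactCoupling.IsSuccessfulExactCoupling P 1 x μ S S' T ∧
        0 < P {ω | T ω = (n₀ : ℕ∞)}) ∧
      ∃ C : ℝ, 0 < C ∧
        (¬ IsOfFinOrder x →
          ∀ (Ω : Type v) [MeasurableSpace Ω] (P : Measure Ω) [IsProbabilityMeasure P]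
            (S S' : Ω → ℕ → G), ExactCoupling.IsRandomWalk P 1 μ S →
            ExactCoupling.IsRandomWalk P x μ S' → ∀ n : ℕ, 1 ≤ n →
            ExactCoupling.totalVariation
              ((P.map (fun ω => S ω n)).toSignedMeasure -
                (P.map (fun ω => S' ω n)).toSignedMeasure) ≤ C / Real.sqrt n) ∧
        (IsOfFinOrder x → ∃ ρ : ℝ, 0 < ρ ∧ ρ < 1 ∧
          ∀ (Ω : Type v) [MeasurableSpace Ω] (P : Measure Ω) [IsProbabilityMeasure P]
            (S S' : Ω → ℕ → G), ExactCoupling.IsRandomWalk P 1 μ S →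
            ExactCoupling.IsRandomWalk P x μ S' → ∀ n : ℕ, 1 ≤ n →
            ExactCoupling.totalVariation
              ((P.map (fun ω => S ω n)).toSignedMeasure -
                (P.map (fun ω => S' ω n)).toSignedMeasure) ≤ C * ρ ^ n)) := by

  refine ⟨ExactCoupling.exists_inf_leftShift_ne_zero, ?_⟩
  rintro n₀ hn₀ hinf ⟨B, hB, hB1, hBx⟩
  have hcomm : ∀ᵐ g ∂(ExactCoupling.convPow μ n₀), x * g = g * x :=
    Filter.mem_of_superset ((mem_ae_iff_prob_eq_one hB).2 hB1) hBx
  obtain ⟨r, hr0, hrlim, hrdom, C, hC, hrC⟩ :=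
    ExactCoupling.exists_sqrt_bound hn₀ hinf hcomm
  have hinf' : ExactCoupling.convPow μ n₀ ⊓
      ExactCoupling.leftShift x (ExactCoupling.convPow μ n₀) ≠ 0 :=
    ExactCoupling.inf_leftShift_ne_zero hinf
  -- The square-root bound holds whatever the order of `x`, so it yields the coupling in both cases.
  have hcoup := ExactCoupling.exists_successful_exactCoupling μ x
    (by simpa using ENNReal.tendsto_ofReal hrlim) hrdom hinf'
  refine ⟨?_, hcoup, ?_⟩
  · obtain ⟨Ω, mΩ, P, hP, S, S', T, h, -⟩ := hcoup
    exact ⟨Ω, mΩ, P, hP, S, S', T, h⟩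
  -- For a given `x` one of the two rate claims is vacuous, so `C` may depend on the case; the
  -- factor 2 comes from total variation being sup minus inf.
  by_cases hfin : IsOfFinOrder x
  · obtain ⟨C, ρ, hC, hρ0, hρ1, hd⟩ :=
      ExactCoupling.exists_geometric_bound hfin hn₀ hinf hcomm
    refine ⟨2 * C, by positivity, fun h => absurd hfin h, fun _ => ⟨ρ, hρ0, hρ1, ?_⟩⟩
    intro Ω _ P _ S S' h h' n _
    rw [mul_assoc]
    exact h.totalVariation_le h' (by positivity) (hd n)
  · refine ⟨2 * C, by positivity, fun _ => ?_, fun h => absurd h hfin⟩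
    intro Ω _ P _ S S' h h' n hn
    rw [mul_div_assoc]
    exact (h.totalVariation_le h' (hr0 n) (hrdom n)).trans (by gcongr; exact hrC n hn)
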